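/- Let $2\le n<m$ be coprime integers, let $\Gamma=\{na+mb : a,b\in\mathbb Z_{\ge 0}\}$, and let $\pi$ be the cuspidal sequence of point blowing-ups over $(\mathbb C^2,0)$ with Puiseux pair $(n,m)$, in coordinates $(x,y)$ adapted to it (that is, $y=0$ has maximal contact with the sequence). Explicitly, after one blowing-up the coordinates at the next center are $(x_1,y_1)$ with $x=x_1,\ y=x_1y_1$ and remaining pair $(n,m-n)$ if $2n\le m$, and with $x=y_1,\ y=x_1y_1$ and remaining pair $(m-n,n)$ if $n<m<2n$; the pair $(1,1)$ stands for one last blowing-up, whose exceptional divisor is denoted by $E$. The divisorial order $\nu_E(\omega)$ of a germ of holomorphic $1$-form $\omega$ at $0\in\mathbb C^2$ is the largest $\ell$ such that $u^{-\ell}\pi^*\omega$ is a logarithmic $1$-form, at a point of $E$, along the total transform of $xy=0$, where $u=0$ is a local reduced equation of $E$ (and $\nu_E(0)=\infty$). Let $\mathcal C$ be an $E$-cusp, i.e. a branch at $0$ whose strict transform by $\pi$ is nonsingular and cuts $E$ transversely at a point belonging to no other component of the exceptional divisor $\pi^{-1}(0)$. For a local parametrization $\phi(t)$ of $\mathcal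 C$, the differential value $\nu_{\mathcal C}(\omega)\in\mathbb Z_{\ge 0}\cup\{\infty\}$ is the order at $t=0$ of $a(t)$, where $\phi^*\omega=a(t)\,dt/t$. Let $\Lambda$ be the set of the finite differential values of holomorphic $1$-forms, and let $(\lambda_{-1},\lambda_0,\ldots,\lambda_s)$ be its basis: the increasing sequence with $\Lambda=\Lambda_s$ and $\lambda_j\notin\Lambda_{j-1}$ for $0\le j\le s$, where $\Lambda_i=\bigcup_{j=-1}^{i}(\lambda_j+\Gamma)$. Let $(\omega_{-1},\omega_0,\ldots,\omega_s)$ be a standard basis, i.e. holomorphic $1$-forms with $\nu_{\mathcal C}(\omega_j)=\lambda_j$ for all $j$. Put $$u_0=\lambda_{-1},\qquad u_i=\min\bigl(\Lambda_{i-2}\cap(\lambda_{i-1}+\Gamma)\bigr)\quad(1\le i\le s+1),$$ $$t_0=m,\qquad t_i=t_{i-1}+u_i-\lambda_{i-1}\quad(1\le i\le s+1).$$ All $1$-forms below are germs of holomorphic $1$-forms at $0$. A $1$-form $\omega'$ is reachable from $\omega$ if there are $a,b\ge 0$ and $\mu\in\mathbb C$ with $\nu_E(\omega'-\mu x^ay^b\omega)>\nu_E(\omega')$.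 A semimodule with basis $(\lambda_{-1},\ldots,\lambda_r)$ is increasing if $\lambda_j>u_j$ for $0\le j\le r$. Then for each $1\le i\le s$: 1. $\lambda_i=\sup\{\nu_{\mathcal C}(\omega) : \nu_E(\omega)=t_i\}$. 2. If $\nu_{\mathcal C}(\omega)=\lambda_i$, then $\nu_E(\omega)=t_i$. 3. If $\nu_{\mathcal C}(\omega)$ is finite and $\nu_{\mathcal C}(\omega)\notin\Lambda_{i-1}$, then $\omega$ is reachable from $\omega_i$, there is a unique pair $a,b\ge 0$ with $\nu_E(\omega)=\nu_E(x^ay^b\omega_i)$, and for this pair $\nu_{\mathcal C}(\omega)\ge\lambda_i+na+mb$. 4. $\lambda_i>u_i$. 5. For all $a,b\ge 0$, with $k=\lambda_i+na+mb$: $k\notin\Lambda_{i-1}$ if and only if every $\omega$ with $\nu_{\mathcal C}(\omega)=k$ satisfies $\nu_E(\omega)\le\nu_E(x^ay^b\omega_i)$. In particular, the semimodule $\Lambda_i$ is increasing for each $1\le i\le s$. -/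

import Mathlib

open Filter Topology

noncomputable section

namespace CuspSemimodule

/-! ### Holomorphic 1-forms and the cuspidal sequence of blowing-ups

The ambient germ is `(ℂ², 0)`, with coordinates `(x, y)` adapted to the cuspidal sequence.
Germs are represented by functions defined on all of `ℂ²`; only their values near the relevant
point matter in what follows. -/

/-- A differential 1-form on the plane: a covector `a dx + b dy` at every point. -/
abbrev Form : Type := ℂ × ℂ → (ℂ × ℂ →L[ℂ] ℂ)

/-- `ω` represents a germ at the origin of a holomorphic 1-form. -/
def IsHolomorphicForm (ω : Form) : Prop := AnalyticAt ℂ ω 0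

/-- Pull-back of a 1-form by a map. -/
def pullback (f : ℂ × ℂ → ℂ × ℂ) (ω : Form) : Form :=
  fun p => (ω (f p)).comp (fderiv ℂ f p)

/-- The 1-form `x ^ a * y ^ b * ω`. -/
def monomialMul (a b : ℕ) (ω : Form) : Form := fun p => (p.1 ^ a * p.2 ^ b) • ω p

/-- The chart `x = x₁`, `y = x₁ y₁` of the blowing-up of the origin;
the exceptional divisor is `x₁ = 0`. -/
def chartFree (p : ℂ × ℂ) : ℂ × ℂ := (p.1, p.1 * p.2)

/-- The chart `x = y₁`, `y = x₁ y₁` of the blowing-up of the origin: it is the same chart with the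
coordinates exchanged, so that the exceptional divisor is `y₁ = 0`. -/
def chartCorner (p : ℂ × ℂ) : ℂ × ℂ := (p.2, p.1 * p.2)

/-- The composition `π` of the cuspidal sequence of blowing-ups with Puiseux pair `(n, m)` having
maximal contact with `y = 0`, in adapted coordinates.

If `2 n ≤ m`, the next center is the origin of the chart `x = x₁`, `y = x₁ y₁`, and the rest of the
sequence has Puiseux pair `(n, m - n)` in the coordinates `(x₁, y₁)`. If `n < m < 2 n`, the next
center is the origin of the chart `x = y₁`, `y = x₁ y₁`, and the rest of the sequence has Puiseux
pair `(m - n, n)`. The pair `(1, 1)` corresponds to one last blowing-up.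

The result is the expression of `π` in the chart `(u, v)` of the last blowing-up in which the last
divisor `E` is `u = 0`; this chart contains all the points of `E` except one. -/
def cuspidalMap (n m : ℕ) : ℂ × ℂ → ℂ × ℂ :=
  if 0 < n ∧ 2 * n ≤ m then chartFree ∘ cuspidalMap n (m - n)
  else if n < m ∧ m < 2 * n then chartCorner ∘ cuspidalMap (m - n) n
  else chartFree
termination_by n + m
decreasing_by all_goals omega

/-- `u ^ (-ℓ) π^* ω` is a germ of logarithmic 1-form `A du/u + B dv/v` along `H = (u v = 0)`, at the
point `u = v = 0` of `E`. Here `H` is the total transform of `x y = 0`. -/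
def HasDivisorialOrderGE (n m : ℕ) (ω : Form) (l : ℕ) : Prop :=
  ∃ A B : ℂ × ℂ → ℂ, AnalyticAt ℂ A 0 ∧ AnalyticAt ℂ B 0 ∧ ∀ᶠ p in 𝓝 (0 : ℂ × ℂ),
    p.1 * pullback (cuspidalMap n m) ω p (1, 0) = p.1 ^ l * A p ∧
    p.2 * pullback (cuspidalMap n m) ω p (0, 1) = p.1 ^ l * B p

/-- The divisorial order `ν_E(ω)`: the largest `ℓ` such that `u ^ (-ℓ) π^* ω` is logarithmic along
`H` (and `⊤` for the zero form). -/
def divisorialOrder (n m : ℕ) (ω : Form) : ℕ∞ :=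
  ⨆ (l : ℕ) (_ : HasDivisorialOrderGE n m ω l), (l : ℕ∞)

/-- `ω'` is reachable from `ω`. -/
def Reachable (n m : ℕ) (ω' ω : Form) : Prop :=
  ∃ (a b : ℕ) (μ : ℂ),
    divisorialOrder n m ω' < divisorialOrder n m (ω' - μ • monomialMul a b ω)

/-! ### Cusps and their differential values -/

/-- `φ` is a local parametrization of an `E`-cusp: `φ = π ∘ ψ`, where `ψ` parametrizes the strict
transform, which is nonsingular and cuts `E` transversely at a free point, that is, at a point
around which the whole exceptional divisor `π⁻¹(0)` reduces to `E = (u = 0)`.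
(When `n ≥ 2`, the only point of `E` outside the chart is not free.) -/
def IsCusp (n m : ℕ) (φ : ℂ → ℂ × ℂ) : Prop :=
  ∃ ψ : ℂ → ℂ × ℂ, AnalyticAt ℂ ψ 0 ∧ φ =ᶠ[𝓝 0] cuspidalMap n m ∘ ψ ∧
    (ψ 0).1 = 0 ∧ (deriv ψ 0).1 ≠ 0 ∧
    ∀ᶠ p in 𝓝 (ψ 0), cuspidalMap n m p = 0 → p.1 = 0

/-- The differential value `ν_C(ω)`: the order at `t = 0` of `a(t)`, where `φ^* ω = a(t) dt/t`. -/
def diffValue (φ : ℂ → ℂ × ℂ) (ω : Form) : ℕ∞ :=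
  analyticOrderAt (fun t : ℂ => t * ω (φ t) (deriv φ t)) 0

/-- The semimodule of differential values: the finite values `ν_C(ω)`. -/
def diffSemimodule (φ : ℂ → ℂ × ℂ) : Set ℕ :=
  {k | ∃ ω : Form, IsHolomorphicForm ω ∧ diffValue φ ω = k}

/-! ### Semimodules over the semigroup generated by `n` and `m` -/

/-- The semigroup generated by `n` and `m`. -/
def semigroup (n m : ℕ) : Set ℕ := {p | ∃ a b : ℕ, p = n * a + m * b}

/-- `Λ_i`, the union of the `λ_j + Γ` for `-1 ≤ j ≤ i`. -/
def truncSemimodule (n m : ℕ) (lam : ℤ → ℕ) (i : ℤ) : Set ℕ :=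
  {p | ∃ j : ℤ, -1 ≤ j ∧ j ≤ i ∧ ∃ q ∈ semigroup n m, p = lam j + q}

/-- `(λ_{-1}, λ_0, …, λ_s)` is the basis of the semimodule `L`. -/
structure IsSemimoduleBasis (n m : ℕ) (s : ℤ) (lam : ℤ → ℕ) (L : Set ℕ) : Prop where
  length_ge : -1 ≤ s
  increasing : ∀ j : ℤ, 0 ≤ j → j ≤ s → lam (j - 1) < lam j
  notMem : ∀ j : ℤ, 0 ≤ j → j ≤ s → lam j ∉ truncSemimodule n m lam (j - 1)
  eq_trunc : L = truncSemimodule n m lam s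

/-- The axes: `u_0 = λ_{-1}` and `u_i = min (Λ_{i-2} ∩ (λ_{i-1} + Γ))` for `i ≥ 1`. -/
def axis (n m : ℕ) (lam : ℤ → ℕ) (i : ℤ) : ℕ :=
  if i = 0 then lam (-1)
  else sInf (truncSemimodule n m lam (i - 2) ∩ {p | ∃ q ∈ semigroup n m, p = lam (i - 1) + q})

/-- The critical divisorial orders: `t_0 = m` and `t_{i+1} = t_i + u_{i+1} - λ_i`.
The subtraction does not truncate, since `u_{i+1}` belongs to `λ_i + Γ`. -/
def critOrder (n m : ℕ) (lam : ℤ → ℕ) : ℕ → ℕ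
  | 0 => m
  | i + 1 => critOrder n m lam i + (axis n m lam (i + 1) - lam i)

/-- A semimodule is increasing if its basis satisfies `λ_j > u_j` for `0 ≤ j ≤ s`. -/
def IsIncreasing (n m : ℕ) (L : Set ℕ) : Prop :=
  ∃ (s : ℤ) (lam : ℤ → ℕ), IsSemimoduleBasis n m s lam L ∧
    ∀ j : ℤ, 0 ≤ j → j ≤ s → axis n m lam j < lam j

/-- `(ω_{-1}, ω_0, …, ω_s)` is a standard basis of the cusp, where `(λ_{-1}, λ_0, …, λ_s)` is the
basis of its semimodule of differential values. -/
def IsStandardBasis (φ : ℂ → ℂ × ℂ) (s : ℤ) (lam : ℤ → ℕ) (ω : ℤ → Form) : Prop :=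
  ∀ j : ℤ, -1 ≤ j → j ≤ s → IsHolomorphicForm (ω j) ∧ diffValue φ (ω j) = lam j

end CuspSemimodule

end

open CuspSemimodule

noncomputable section

namespace CuspSemimodule

/-! ### Weighted filtration of holomorphic forms -/

/-! Give x^a y^b dx/x and x^a y^b dy/y the weight n a + m b. In the last chart π is monomial with a
unimodular exponent matrix, so up to level n m the order ν_E is the weight filtration
(`mem_weightForms_of_hasDivisorialOrderGE` and its converse). Below n m a weight determines its
monomial, so a form of order p < n m has an initial part x^a y^b (A dx/x + B dy/y). An E-cusp is
(t^n X, t^m Y) with units X, Y; hence in this range ν_C ≥ ν_E, strictly exactly when n A + m B = 0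
(the form is resonant). Two resonant forms of equal order thus have proportional initial parts, and
a combination of them raises ν_E; two forms of equal value have a combination that raises ν_C.
`IsOrderPair` collects these facts, and the induction uses nothing else about forms. It applies
because Λ_0 contains the positive part of Γ, so every value outside Λ_0 is less than n m.

The induction on i (`IsCritical`) says that value λ_i forces order t_i, and that a value k outside
Λ_{i-1} forces an order t_i + q, q in Γ, with λ_i + q ≤ k. To pass to i + 1, take η with value k
outside Λ_i and order that of x^a y^b ω_i. A combination of the two has larger order and the smaller
value λ_i + n a + m b; by induction this value must lie in Λ_{i-1}. The combinatorics of
`IsConeVertex.succ` then places (a, b) above the exponent (a₀, b₀) of u_{i+1} = λ_i + n a₀ + m b₀.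
So k > u_{i+1} and the order lies in t_{i+1} + Γ.

Conversely x^a₀ y^b₀ ω_i has order t_{i+1} and value u_{i+1}. Values of Λ_i at this level and above,
other than those of ω_i itself at u_{i+1}, are realised by forms of order greater than t_{i+1}.
Subtracting these raises the value to at least λ_{i+1} without changing the order
(`exists_lam_le_c`). The resulting form bounds the values of all others (`c_add_le`), which closes
the induction.

The combinatorial invariant is that the gaps of Λ_{i-1} beyond u_i form a cone U - n a - m b with a,
b ≥ 1, as for the gaps of Γ itself. -/

theorem analyticAt_clm_apply_const {E : Type*} [NormedAddCommGroup E] [NormedSpace ℂ E] {z : E}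
    {S : E → (ℂ × ℂ →L[ℂ] ℂ)} (hS : AnalyticAt ℂ S z) (v : ℂ × ℂ) :
    AnalyticAt ℂ (fun z => S z v) z :=
  ((ContinuousLinearMap.apply ℂ ℂ v).analyticAt _).comp hS

/-- The shifted power series sums to an analytic covector field S with h z = h 0 + S z z; its two
components are the required cofactors. -/
theorem exists_eq_add_fst_mul_add_snd_mul {h : ℂ × ℂ → ℂ} (hh : AnalyticAt ℂ h 0) :
    ∃ k l : ℂ × ℂ → ℂ, AnalyticAt ℂ k 0 ∧ AnalyticAt ℂ l 0 ∧
      ∀ᶠ z in 𝓝 (0 : ℂ × ℂ), h z = h 0 + z.1 * k z + z.2 * l z := by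
  obtain ⟨p, r, hp⟩ := hh
  have hq : HasFPowerSeriesOnBall p.shift.sum p.shift 0 r := by
    have hr : r ≤ p.shift.radius := by
      rw [FormalMultilinearSeries.radius_shift]; exact hp.r_le
    exact (p.shift.hasFPowerSeriesOnBall (hp.r_pos.trans_le hr)).mono hp.r_pos hr
  have hS : AnalyticAt ℂ p.shift.sum 0 := hq.analyticAt
  have hu := hq.unshift (z := h 0)
  have hpq : p.shift.unshift (h 0) = p := by
    ext k v
    cases k with
    | zero =>
      have := hp.coeff_zero v
      simp only [FormalMultilinearSeries.unshift]
      rw [this]; rfl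
    | succ k =>
      simp [FormalMultilinearSeries.unshift, FormalMultilinearSeries.shift]
  rw [hpq] at hu
  have heq := hp.unique hu
  refine ⟨fun z => p.shift.sum z (1, 0), fun z => p.shift.sum z (0, 1),
    analyticAt_clm_apply_const hS _, analyticAt_clm_apply_const hS _, ?_⟩
  filter_upwards [Metric.eball_mem_nhds (0 : ℂ × ℂ) hp.r_pos] with z hz
  have h1 := heq hz
  have h2 : z = z.1 • ((1 : ℂ), (0 : ℂ)) + z.2 • ((0 : ℂ), (1 : ℂ)) := by
    ext <;> simp
  calc h z = h 0 + p.shift.sum z z := by simpa using h1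
    _ = h 0 + p.shift.sum z (z.1 • ((1 : ℂ), (0 : ℂ)) + z.2 • ((0 : ℂ), (1 : ℂ))) := by
        rw [← h2]
    _ = _ := by rw [map_add, map_smul, map_smul]; simp [add_assoc]

/-- The form `h dx`. -/
def formDx (h : ℂ × ℂ → ℂ) : Form := fun z => h z • ContinuousLinearMap.fst ℂ ℂ ℂ

/-- The form `h dy`. -/
def formDy (h : ℂ × ℂ → ℂ) : Form := fun z => h z • ContinuousLinearMap.snd ℂ ℂ ℂ

/-- Forms all of whose logarithmic monomials `x ^ a y ^ b dx / x`, `x ^ a y ^ b dy / y` have weight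
`n a + m b ≥ p`. -/
def weightForms (n m p : ℕ) : Submodule ℂ Form :=
  Submodule.span ℂ {η | ∃ (a b : ℕ) (h : ℂ × ℂ → ℂ), AnalyticAt ℂ h 0 ∧
    ((p ≤ n * (a + 1) + m * b ∧ η =ᶠ[𝓝 0] formDx fun z => z.1 ^ a * z.2 ^ b * h z) ∨
     (p ≤ n * a + m * (b + 1) ∧ η =ᶠ[𝓝 0] formDy fun z => z.1 ^ a * z.2 ^ b * h z))}

/-- The form `x ^ a y ^ b (A dx / x + B dy / y)`. -/
def logForm (a b : ℕ) (A B : ℂ) : Form :=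
  formDx (fun z => A * (z.1 ^ (a - 1) * z.2 ^ b)) +
    formDy (fun z => B * (z.1 ^ a * z.2 ^ (b - 1)))

variable {n m p : ℕ}

theorem formDx_mem_weightForms {a b : ℕ} {h : ℂ × ℂ → ℂ} {η : Form} (hh : AnalyticAt ℂ h 0)
    (hp : p ≤ n * (a + 1) + m * b)
    (hη : η =ᶠ[𝓝 0] formDx fun z => z.1 ^ a * z.2 ^ b * h z) : η ∈ weightForms n m p :=
  Submodule.subset_span ⟨a, b, h, hh, .inl ⟨hp, hη⟩⟩

theorem formDy_mem_weightForms {a b : ℕ} {h : ℂ × ℂ → ℂ} {η : Form} (hh : AnalyticAt ℂ h 0)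
    (hp : p ≤ n * a + m * (b + 1))
    (hη : η =ᶠ[𝓝 0] formDy fun z => z.1 ^ a * z.2 ^ b * h z) : η ∈ weightForms n m p :=
  Submodule.subset_span ⟨a, b, h, hh, .inr ⟨hp, hη⟩⟩

theorem mem_weightForms_of_isHolomorphicForm (hnm : n ≤ m) {η : Form} (hη : IsHolomorphicForm η) :
    η ∈ weightForms n m n := by
  have h : η = formDx (fun z => z.1 ^ 0 * z.2 ^ 0 * η z (1, 0)) +
      formDy (fun z => z.1 ^ 0 * z.2 ^ 0 * η z (0, 1)) := by
    funext z
    ext <;> simp [formDx, formDy]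
  rw [h]
  exact add_mem
    (formDx_mem_weightForms (a := 0) (b := 0) (analyticAt_clm_apply_const hη _) (by simp) .rfl)
    (formDy_mem_weightForms (a := 0) (b := 0) (analyticAt_clm_apply_const hη _) (by simpa) .rfl)

theorem weightForms_le_succ (hp : ∀ a b, p ≠ n * a + m * b) :
    weightForms n m p ≤ weightForms n m (p + 1) := by
  refine Submodule.span_le.2 ?_
  rintro η ⟨a, b, h, hh, ⟨h1, h2⟩ | ⟨h1, h2⟩⟩
  · exact formDx_mem_weightForms hh (by have := hp (a + 1) b; omega) h2
  · exact formDy_mem_weightForms hh (by have := hp a (b + 1); omega) h2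

theorem weightForms_succ_le : weightForms n m (p + 1) ≤ weightForms n m p := by
  refine Submodule.span_le.2 ?_
  rintro η ⟨a, b, h, hh, ⟨h1, h2⟩ | ⟨h1, h2⟩⟩
  · exact formDx_mem_weightForms hh (by omega) h2
  · exact formDy_mem_weightForms hh (by omega) h2

/-- Below `n m` a weight is represented by at most one monomial. -/
theorem weight_injective (hcop : Nat.Coprime n m) {a b a' b' : ℕ}
    (hlt : n * a + m * b < n * m) (heq : n * a + m * b = n * a' + m * b') :
    a = a' ∧ b = b' := by
  have hn : 0 < n := by rcases Nat.eq_zero_or_pos n with rfl | h <;> simp_all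
  have hm : 0 < m := by rcases Nat.eq_zero_or_pos m with rfl | h <;> simp_all
  have ha : a < m := by nlinarith
  have ha' : a' < m := by nlinarith
  have h1 : n * a ≡ n * a' [MOD m] := by
    have h2 : (n * a + m * b) ≡ (n * a' + m * b') [MOD m] := by rw [heq]
    simpa [Nat.ModEq] using h2
  have h3 : a ≡ a' [MOD m] := Nat.ModEq.cancel_left_of_coprime (by simpa [Nat.gcd_comm] using hcop) h1
  have h4 : a = a' := by
    unfold Nat.ModEq at h3
    rwa [Nat.mod_eq_of_lt ha, Nat.mod_eq_of_lt ha'] at h3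
  subst h4
  refine ⟨rfl, Nat.eq_of_mul_eq_mul_left hm (by omega)⟩

theorem monomialMul_mem_weightForms (a b : ℕ) {η : Form} (hη : η ∈ weightForms n m p) :
    monomialMul a b η ∈ weightForms n m (p + (n * a + m * b)) := by
  induction hη using Submodule.span_induction with
  | mem η h =>
    obtain ⟨a', b', h, hh, ⟨h1, h2⟩ | ⟨h1, h2⟩⟩ := h
    · refine formDx_mem_weightForms (a := a + a') (b := b + b') hh (by nlinarith) ?_
      filter_upwards [h2] with z hz
      simp only [monomialMul, hz, formDx, smul_smul]
      congr 1; ring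
    · refine formDy_mem_weightForms (a := a + a') (b := b + b') hh (by nlinarith) ?_
      filter_upwards [h2] with z hz
      simp only [monomialMul, hz, formDy, smul_smul]
      congr 1; ring
  | zero =>
    convert Submodule.zero_mem _ using 1
    funext z; simp [monomialMul]
  | add η θ _ _ h1 h2 =>
    convert add_mem h1 h2 using 1
    funext z; simp [monomialMul]
  | smul μ η _ h1 =>
    convert Submodule.smul_mem _ μ h1 using 1
    funext z; simp only [monomialMul, Pi.smul_apply]; rw [smul_comm]

theorem logForm_add (a b : ℕ) (A B A' B' : ℂ) :
    logForm a b (A + A') (B + B') = logForm a b A B + logForm a b A' B' := by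
  funext z; ext <;> simp [logForm, formDx, formDy] <;> ring

theorem logForm_smul (a b : ℕ) (μ A B : ℂ) :
    logForm a b (μ * A) (μ * B) = μ • logForm a b A B := by
  funext z; ext <;> simp [logForm, formDx, formDy] <;> ring

theorem logForm_zero (a b : ℕ) : logForm a b 0 0 = 0 := by
  funext z; ext <;> simp [logForm, formDx, formDy]

/-- The truncated exponent a - 1 is harmless only because A vanishes when a = 0, and similarly for b
and B. These side conditions say that the logarithmic monomial is holomorphic. -/
theorem logForm_mem_weightForms {a b : ℕ} {A B : ℂ} (ha : a = 0 → A = 0) (hb : b = 0 → B = 0) :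
    logForm a b A B ∈ weightForms n m (n * a + m * b) := by
  refine add_mem ?_ ?_
  · by_cases h : a = 0
    · rw [ha h]
      convert Submodule.zero_mem _ using 1
      funext z; ext <;> simp [formDx]
    · obtain ⟨a, rfl⟩ := Nat.exists_eq_succ_of_ne_zero h
      refine formDx_mem_weightForms (a := a) (b := b) (h := fun _ => A) analyticAt_const le_rfl ?_
      refine .of_forall fun z => ?_
      simp [formDx, mul_comm]
  · by_cases h : b = 0
    · rw [hb h]
      convert Submodule.zero_mem _ using 1
      funext z; ext <;> simp [formDy]
    · obtain ⟨b, rfl⟩ := Nat.exists_eq_succ_of_ne_zero h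
      refine formDy_mem_weightForms (a := a) (b := b) (h := fun _ => B) analyticAt_const le_rfl ?_
      refine .of_forall fun z => ?_
      simp [formDy, mul_comm]

/-- The initial part of a form of weight `p < n m`. -/
theorem exists_sub_logForm_mem (hn : 0 < n) (hm : 0 < m) (hcop : Nat.Coprime n m) {a b : ℕ}
    (hlt : n * a + m * b < n * m) {η : Form} (hη : η ∈ weightForms n m (n * a + m * b)) :
    ∃ A B : ℂ, (a = 0 → A = 0) ∧ (b = 0 → B = 0) ∧
      η - logForm a b A B ∈ weightForms n m (n * a + m * b + 1) := by
  induction hη using Submodule.span_induction with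
  | mem η h =>
    obtain ⟨a', b', h, hh, ⟨h1, h2⟩ | ⟨h1, h2⟩⟩ := h
    · rcases h1.lt_or_eq with h1 | h1
      · exact ⟨0, 0, by simp, by simp, by
          rw [logForm_zero, sub_zero]; exact formDx_mem_weightForms hh h1 h2⟩
      · obtain ⟨rfl, rfl⟩ := weight_injective hcop hlt h1
        -- Replacing h by its constant term leaves multiples of x and y, whose weight is larger by n
        -- or m.
        obtain ⟨k, l, hk, hl, hkl⟩ := exists_eq_add_fst_mul_add_snd_mul hh
        refine ⟨h 0, 0, by simp, by simp, ?_⟩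
        have h3 : formDx (fun z => z.1 ^ (a' + 1) * z.2 ^ b * k z) +
            formDx (fun z => z.1 ^ a' * z.2 ^ (b + 1) * l z) ∈
            weightForms n m (n * (a' + 1) + m * b + 1) :=
          add_mem (formDx_mem_weightForms hk (by nlinarith) .rfl)
            (formDx_mem_weightForms hl (by nlinarith) .rfl)
        have h4 : η - logForm (a' + 1) b (h 0) 0 - (formDx (fun z => z.1 ^ (a' + 1) * z.2 ^ b * k z) +
            formDx (fun z => z.1 ^ a' * z.2 ^ (b + 1) * l z)) ∈
            weightForms n m (n * (a' + 1) + m * b + 1) := by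
          refine formDx_mem_weightForms (a := a' + 1) (b := b) (h := fun _ => 0) analyticAt_const
            (by nlinarith) ?_
          filter_upwards [h2, hkl] with z hz hz'
          ext <;> simp [hz, hz', logForm, formDx, formDy]
          ring
        simpa using add_mem h4 h3
    · rcases h1.lt_or_eq with h1 | h1
      · exact ⟨0, 0, by simp, by simp, by
          rw [logForm_zero, sub_zero]; exact formDy_mem_weightForms hh h1 h2⟩
      · obtain ⟨rfl, rfl⟩ := weight_injective hcop hlt h1
        obtain ⟨k, l, hk, hl, hkl⟩ := exists_eq_add_fst_mul_add_snd_mul hh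
        refine ⟨0, h 0, by simp, by simp, ?_⟩
        have h3 : formDy (fun z => z.1 ^ (a + 1) * z.2 ^ b' * k z) +
            formDy (fun z => z.1 ^ a * z.2 ^ (b' + 1) * l z) ∈
            weightForms n m (n * a + m * (b' + 1) + 1) :=
          add_mem (formDy_mem_weightForms hk (by nlinarith) .rfl)
            (formDy_mem_weightForms hl (by nlinarith) .rfl)
        have h4 : η - logForm a (b' + 1) 0 (h 0) - (formDy (fun z => z.1 ^ (a + 1) * z.2 ^ b' * k z) +
            formDy (fun z => z.1 ^ a * z.2 ^ (b' + 1) * l z)) ∈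
            weightForms n m (n * a + m * (b' + 1) + 1) := by
          refine formDy_mem_weightForms (a := a) (b := b' + 1) (h := fun _ => 0) analyticAt_const
            (by nlinarith) ?_
          filter_upwards [h2, hkl] with z hz hz'
          ext <;> simp [hz, hz', logForm, formDx, formDy]
          ring
        simpa using add_mem h4 h3
  | zero => exact ⟨0, 0, by simp, by simp, by rw [logForm_zero]; simp⟩
  | add η θ _ _ h1 h2 =>
    obtain ⟨A, B, hA, hB, h⟩ := h1
    obtain ⟨A', B', hA', hB', h'⟩ := h2
    refine ⟨A + A', B + B', fun h => by simp [hA h, hA' h], fun h => by simp [hB h, hB' h], ?_⟩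
    rw [logForm_add, add_sub_add_comm]
    exact add_mem h h'
  | smul μ η _ h1 =>
    obtain ⟨A, B, hA, hB, h⟩ := h1
    refine ⟨μ * A, μ * B, fun h => by simp [hA h], fun h => by simp [hB h], ?_⟩
    rw [logForm_smul, ← smul_sub]
    exact Submodule.smul_mem _ _ h

/-! ### The divisorial order in terms of the weighted filtration -/

/-- Each chart multiplies the exponent matrix by a unimodular matrix. The corner chart reverses the
sign of the determinant, hence the two alternatives over the natural numbers. -/
theorem exists_cuspidalMap_eq : ∀ {n m : ℕ}, 0 < n → n ≤ m → Nat.Coprime n m →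
    ∃ α β : ℕ, (n * β = m * α + 1 ∨ m * α = n * β + 1) ∧
      ∀ p : ℂ × ℂ, cuspidalMap n m p = (p.1 ^ n * p.2 ^ α, p.1 ^ m * p.2 ^ β) := by
  suffices H : ∀ N n m : ℕ, n + m ≤ N → 0 < n → n ≤ m → Nat.Coprime n m →
      ∃ α β : ℕ, (n * β = m * α + 1 ∨ m * α = n * β + 1) ∧
        ∀ p : ℂ × ℂ, cuspidalMap n m p = (p.1 ^ n * p.2 ^ α, p.1 ^ m * p.2 ^ β) from
    fun {n m} => H (n + m) n m le_rfl
  intro N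
  induction N with
  | zero => intro n m h1 h2; omega
  | succ N ih =>
    intro n m hN hn hnm hcop
    rw [cuspidalMap]
    split_ifs with h1 h2
    · obtain ⟨d, rfl⟩ := Nat.exists_eq_add_of_le hnm
      rw [Nat.add_sub_cancel_left]
      obtain ⟨α, β, hd, h⟩ := ih n d (by omega) hn (by omega) (by simpa using hcop)
      refine ⟨α, α + β, ?_, fun p => ?_⟩
      · rcases hd with hd | hd
        · left; linarith
        · right; linarith
      · simp only [Function.comp, h, chartFree]
        ext <;> simp; ring
    · obtain ⟨d, rfl⟩ := Nat.exists_eq_add_of_le hnm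
      rw [Nat.add_sub_cancel_left]
      obtain ⟨α, β, hd, h⟩ := ih d n (by omega) (by omega) (by omega)
        (by simpa [Nat.coprime_comm] using hcop)
      refine ⟨β, α + β, ?_, fun p => ?_⟩
      · rcases hd with hd | hd
        · right; linarith
        · left; linarith
      · simp only [Function.comp, h, chartCorner]
        ext <;> simp; ring
    · have : n = m := by omega
      subst this
      have : n = 1 := by simpa using hcop
      subst this
      exact ⟨0, 1, by simp, fun p => by simp [chartFree]⟩

/-- On logarithmic vectors a monomial map acts by its exponent matrix, and no division is needed
along the axes. -/
theorem fderiv_monomialMap (a b c d : ℕ) (p q : ℂ × ℂ) :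
    fderiv ℂ (fun p : ℂ × ℂ => (p.1 ^ a * p.2 ^ b, p.1 ^ c * p.2 ^ d)) p (p.1 * q.1, p.2 * q.2) =
      ((a * q.1 + b * q.2) * (p.1 ^ a * p.2 ^ b), (c * q.1 + d * q.2) * (p.1 ^ c * p.2 ^ d)) := by
  have key : ∀ a b : ℕ, fderiv ℂ (fun p : ℂ × ℂ => p.1 ^ a * p.2 ^ b) p (p.1 * q.1, p.2 * q.2) =
      (a * q.1 + b * q.2) * (p.1 ^ a * p.2 ^ b) := by
    intro a b
    have h1 : HasFDerivAt (fun p : ℂ × ℂ => p.1) (ContinuousLinearMap.fst ℂ ℂ ℂ) p :=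
      hasFDerivAt_fst
    have h2 : HasFDerivAt (fun p : ℂ × ℂ => p.2) (ContinuousLinearMap.snd ℂ ℂ ℂ) p :=
      hasFDerivAt_snd
    have h3 : HasFDerivAt (fun p : ℂ × ℂ => p.1 ^ a * p.2 ^ b) _ p := (h1.pow a).mul (h2.pow b)
    rw [h3.fderiv]
    rcases a with _ | a <;> rcases b with _ | b <;> simp <;> ring
  rw [DifferentiableAt.fderiv_prodMk (by fun_prop) (by fun_prop)]
  simp only [ContinuousLinearMap.prod_apply, key]

attribute [local fun_prop] analyticAt_fst analyticAt_snd

theorem pullback_monomialMap {a b c d : ℕ} {f : ℂ × ℂ → ℂ × ℂ}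
    (hf : ∀ p : ℂ × ℂ, f p = (p.1 ^ a * p.2 ^ b, p.1 ^ c * p.2 ^ d)) (η : Form) (p : ℂ × ℂ) :
    p.1 * pullback f η p (1, 0) = η (f p) (a * (f p).1, c * (f p).2) ∧
    p.2 * pullback f η p (0, 1) = η (f p) (b * (f p).1, d * (f p).2) := by
  have hf' : f = fun p : ℂ × ℂ => (p.1 ^ a * p.2 ^ b, p.1 ^ c * p.2 ^ d) := funext hf
  have h1 := fderiv_monomialMap a b c d p (1, 0)
  have h2 := fderiv_monomialMap a b c d p (0, 1)
  rw [← hf'] at h1 h2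
  simp only [mul_one, mul_zero, add_zero, zero_add] at h1 h2
  have e1 : (p.1, (0 : ℂ)) = p.1 • ((1 : ℂ), (0 : ℂ)) := by ext <;> simp
  have e2 : ((0 : ℂ), p.2) = p.2 • ((0 : ℂ), (1 : ℂ)) := by ext <;> simp
  constructor
  · have : p.1 * pullback f η p (1, 0) = η (f p) (fderiv ℂ f p (p.1 • ((1 : ℂ), (0 : ℂ)))) := by
      rw [map_smul, map_smul]; rfl
    rw [this, ← e1, h1, hf]
  · have : p.2 * pullback f η p (0, 1) = η (f p) (fderiv ℂ f p (p.2 • ((0 : ℂ), (1 : ℂ)))) := by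
      rw [map_smul, map_smul]; rfl
    rw [this, ← e2, h2, hf]

namespace HasDivisorialOrderGE

theorem add {η θ : Form} {l : ℕ} (h : HasDivisorialOrderGE n m η l)
    (h' : HasDivisorialOrderGE n m θ l) : HasDivisorialOrderGE n m (η + θ) l := by
  obtain ⟨A, B, hA, hB, h⟩ := h
  obtain ⟨A', B', hA', hB', h'⟩ := h'
  refine ⟨A + A', B + B', hA.add hA', hB.add hB', ?_⟩
  filter_upwards [h, h'] with z hz hz'
  simp only [pullback, Pi.add_apply, ContinuousLinearMap.comp_apply,
    add_apply] at hz hz' ⊢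
  constructor
  · linear_combination hz.1 + hz'.1
  · linear_combination hz.2 + hz'.2

theorem smul {η : Form} {l : ℕ} (μ : ℂ) (h : HasDivisorialOrderGE n m η l) :
    HasDivisorialOrderGE n m (μ • η) l := by
  obtain ⟨A, B, hA, hB, h⟩ := h
  refine ⟨fun z => μ * A z, fun z => μ * B z, analyticAt_const.mul hA, analyticAt_const.mul hB, ?_⟩
  filter_upwards [h] with z hz
  simp only [pullback, Pi.smul_apply, ContinuousLinearMap.comp_apply,
    smul_apply, smul_eq_mul] at hz ⊢
  constructor
  · linear_combination μ * hz.1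
  · linear_combination μ * hz.2

theorem sub {η θ : Form} {l : ℕ} (h : HasDivisorialOrderGE n m η l)
    (h' : HasDivisorialOrderGE n m θ l) : HasDivisorialOrderGE n m (η - θ) l := by
  have h1 : η - θ = η + (-1 : ℂ) • θ := by module
  exact h1 ▸ h.add (h'.smul (-1))

theorem zero (n m l : ℕ) : HasDivisorialOrderGE n m 0 l :=
  ⟨0, 0, analyticAt_const, analyticAt_const, by simp [pullback]⟩

theorem mono {η : Form} {k l : ℕ} (hkl : k ≤ l) (h : HasDivisorialOrderGE n m η l) :
    HasDivisorialOrderGE n m η k := by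
  obtain ⟨A, B, hA, hB, h⟩ := h
  refine ⟨fun z => z.1 ^ (l - k) * A z, fun z => z.1 ^ (l - k) * B z, by fun_prop, by fun_prop, ?_⟩
  filter_upwards [h] with z hz
  rw [hz.1, hz.2, ← mul_assoc, ← mul_assoc, ← pow_add, Nat.add_sub_cancel' hkl]
  exact ⟨rfl, rfl⟩

end HasDivisorialOrderGE

theorem analyticAt_monomialMap_and_apply_zero {a b c d : ℕ} (ha : 0 < a) (hc : 0 < c) {f : ℂ × ℂ → ℂ × ℂ}
    (hf : ∀ p : ℂ × ℂ, f p = (p.1 ^ a * p.2 ^ b, p.1 ^ c * p.2 ^ d)) :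
    AnalyticAt ℂ f 0 ∧ f 0 = 0 := by
  have hf' : f = fun p : ℂ × ℂ => (p.1 ^ a * p.2 ^ b, p.1 ^ c * p.2 ^ d) := funext hf
  constructor
  · rw [hf']; fun_prop
  · rw [hf]; simp [ha.ne', hc.ne']

theorem hasDivisorialOrderGE_of_mem_weightForms (hn : 0 < n) (hnm : n ≤ m)
    (hcop : Nat.Coprime n m) {η : Form} (hη : η ∈ weightForms n m p) :
    HasDivisorialOrderGE n m η p := by
  obtain ⟨α, β, -, hπ⟩ := exists_cuspidalMap_eq hn hnm hcop
  obtain ⟨hπa, hπ0⟩ := analyticAt_monomialMap_and_apply_zero hn (hn.trans_le hnm) hπ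
  induction hη using Submodule.span_induction with
  | mem η h =>
    obtain ⟨a, b, h, hh, ⟨h1, h2⟩ | ⟨h1, h2⟩⟩ := h
    · obtain ⟨d, hd⟩ := Nat.exists_eq_add_of_le h1
      have hhπ : AnalyticAt ℂ (fun z => h (cuspidalMap n m z)) 0 := by
        rw [← hπ0] at hh; exact hh.comp hπa
      have h2' := (hπ0 ▸ hπa.continuousAt.tendsto : Tendsto _ _ (𝓝 (0 : ℂ × ℂ))).eventually h2
      have hM : AnalyticAt ℂ (fun z : ℂ × ℂ => z.1 ^ d * z.2 ^ (α * (a + 1) + β * b)) 0 := by fun_prop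
      refine ⟨fun z => n * (z.1 ^ d * z.2 ^ (α * (a + 1) + β * b) * h (cuspidalMap n m z)),
        fun z => α * (z.1 ^ d * z.2 ^ (α * (a + 1) + β * b) * h (cuspidalMap n m z)),
        analyticAt_const.mul (hM.mul hhπ), analyticAt_const.mul (hM.mul hhπ), ?_⟩
      filter_upwards [h2'] with z hz
      obtain ⟨e1, e2⟩ := pullback_monomialMap hπ η z
      have e3 : z.1 ^ p * z.1 ^ d = z.1 ^ (n * (a + 1) + m * b) := by rw [hd, pow_add]
      rw [e1, e2, hz]
      simp only [formDx, smul_apply, ContinuousLinearMap.coe_fst', smul_eq_mul]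
      constructor
      · rw [mul_left_comm (z.1 ^ p), ← mul_assoc (z.1 ^ p), ← mul_assoc (z.1 ^ p), e3]
        simp only [hπ]; ring
      · rw [mul_left_comm (z.1 ^ p), ← mul_assoc (z.1 ^ p), ← mul_assoc (z.1 ^ p), e3]
        simp only [hπ]; ring
    · obtain ⟨d, hd⟩ := Nat.exists_eq_add_of_le h1
      have hhπ : AnalyticAt ℂ (fun z => h (cuspidalMap n m z)) 0 := by
        rw [← hπ0] at hh; exact hh.comp hπa
      have h2' := (hπ0 ▸ hπa.continuousAt.tendsto : Tendsto _ _ (𝓝 (0 : ℂ × ℂ))).eventually h2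
      have hM : AnalyticAt ℂ (fun z : ℂ × ℂ => z.1 ^ d * z.2 ^ (α * a + β * (b + 1))) 0 := by fun_prop
      refine ⟨fun z => m * (z.1 ^ d * z.2 ^ (α * a + β * (b + 1)) * h (cuspidalMap n m z)),
        fun z => β * (z.1 ^ d * z.2 ^ (α * a + β * (b + 1)) * h (cuspidalMap n m z)),
        analyticAt_const.mul (hM.mul hhπ), analyticAt_const.mul (hM.mul hhπ), ?_⟩
      filter_upwards [h2'] with z hz
      obtain ⟨e1, e2⟩ := pullback_monomialMap hπ η z
      have e3 : z.1 ^ p * z.1 ^ d = z.1 ^ (n * a + m * (b + 1)) := by rw [hd, pow_add]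
      rw [e1, e2, hz]
      simp only [formDy, smul_apply, ContinuousLinearMap.coe_snd', smul_eq_mul]
      constructor
      · rw [mul_left_comm (z.1 ^ p), ← mul_assoc (z.1 ^ p), ← mul_assoc (z.1 ^ p), e3]
        simp only [hπ]; ring
      · rw [mul_left_comm (z.1 ^ p), ← mul_assoc (z.1 ^ p), ← mul_assoc (z.1 ^ p), e3]
        simp only [hπ]; ring
  | zero => exact .zero n m p
  | add η θ _ _ h1 h2 => exact h1.add h2
  | smul μ η _ h1 => exact h1.smul μ

/-- Along the curve u = s^(k+1), v = s, the factor u vanishes faster than v^k, so the identity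
becomes C = s A, which tends to 0. -/
theorem eq_zero_of_mul_pow_eq {C : ℂ} {p k : ℕ} {A : ℂ × ℂ → ℂ} (hA : ContinuousAt A 0)
    (h : ∀ᶠ z in 𝓝 (0 : ℂ × ℂ), C * (z.1 ^ p * z.2 ^ k) = z.1 ^ (p + 1) * A z) : C = 0 := by
  have hγ : Tendsto (fun s : ℂ => (s ^ (k + 1), s)) (𝓝 0) (𝓝 (0 : ℂ × ℂ)) := by
    have : ContinuousAt (fun s : ℂ => (s ^ (k + 1), s)) 0 := by fun_prop
    simpa [ContinuousAt, Prod.zero_eq_mk] using this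
  have h1 : Tendsto (fun s : ℂ => s * A (s ^ (k + 1), s)) (𝓝[≠] 0) (𝓝 0) := by
    have := (tendsto_id (x := 𝓝 (0 : ℂ))).mul (hA.tendsto.comp hγ)
    simpa using this.mono_left nhdsWithin_le_nhds
  have h2 : Tendsto (fun s : ℂ => s * A (s ^ (k + 1), s)) (𝓝[≠] 0) (𝓝 C) := by
    refine tendsto_const_nhds.congr' ?_
    filter_upwards [(hγ.eventually h).filter_mono nhdsWithin_le_nhds, self_mem_nhdsWithin]
      with s hs hs0
    have hs0 : s ≠ 0 := hs0
    have h3 : (s ^ (k + 1)) ^ p * s ^ k ≠ 0 := by positivity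
    refine mul_left_cancel₀ h3 ?_
    rw [mul_comm, hs]; ring
  exact tendsto_nhds_unique h2 h1

theorem logForm_apply_mul {a b : ℕ} {A B : ℂ} (ha : a = 0 → A = 0) (hb : b = 0 → B = 0) (z : ℂ × ℂ)
    (c d : ℂ) : logForm a b A B z (c * z.1, d * z.2) = (c * A + d * B) * (z.1 ^ a * z.2 ^ b) := by
  have h1 : A * (z.1 ^ (a - 1) * z.2 ^ b) * (c * z.1) = c * A * (z.1 ^ a * z.2 ^ b) := by
    rcases a with _ | a
    · simp [ha]
    · simp; ring
  have h2 : B * (z.1 ^ a * z.2 ^ (b - 1)) * (d * z.2) = d * B * (z.1 ^ a * z.2 ^ b) := by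
    rcases b with _ | b
    · simp [hb]
    · simp; ring
  simp only [logForm, formDx, formDy, Pi.add_apply, add_apply,
    smul_apply, ContinuousLinearMap.coe_fst', ContinuousLinearMap.coe_snd',
    smul_eq_mul]
  linear_combination h1 + h2

/-- Up to a common monomial, the pull-back has coefficients n A + m B on du/u and α A + β B on dv/v.
Both must vanish, and the exponent matrix is invertible. -/
theorem eq_zero_of_hasDivisorialOrderGE_logForm (hn : 0 < n) (hnm : n ≤ m)
    (hcop : Nat.Coprime n m) {a b : ℕ} {A B : ℂ} (ha : a = 0 → A = 0) (hb : b = 0 → B = 0)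
    (h : HasDivisorialOrderGE n m (logForm a b A B) (n * a + m * b + 1)) : A = 0 ∧ B = 0 := by
  obtain ⟨α, β, hdet, hπ⟩ := exists_cuspidalMap_eq hn hnm hcop
  obtain ⟨F, G, hF, hG, h⟩ := h
  have key : ∀ z, z.1 * pullback (cuspidalMap n m) (logForm a b A B) z (1, 0) =
        (n * A + m * B) * (z.1 ^ (n * a + m * b) * z.2 ^ (α * a + β * b)) ∧
      z.2 * pullback (cuspidalMap n m) (logForm a b A B) z (0, 1) =
        (α * A + β * B) * (z.1 ^ (n * a + m * b) * z.2 ^ (α * a + β * b)) := by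
    intro z
    obtain ⟨e1, e2⟩ := pullback_monomialMap hπ (logForm a b A B) z
    rw [e1, e2, logForm_apply_mul ha hb, logForm_apply_mul ha hb, hπ]
    constructor <;> ring
  have h1 : (n * A + m * B : ℂ) = 0 :=
    eq_zero_of_mul_pow_eq hF.continuousAt (h.mono fun z hz => (key z).1.symm.trans hz.1)
  have h2 : (α * A + β * B : ℂ) = 0 :=
    eq_zero_of_mul_pow_eq hG.continuousAt (h.mono fun z hz => (key z).2.symm.trans hz.2)
  rcases hdet with hd | hd
  · have hd : (n * β : ℂ) = m * α + 1 := by exact_mod_cast hd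
    constructor
    · linear_combination β * h1 - m * h2 - A * hd
    · linear_combination n * h2 - α * h1 - B * hd
  · have hd : (m * α : ℂ) = n * β + 1 := by exact_mod_cast hd
    constructor
    · linear_combination m * h2 - β * h1 - A * hd
    · linear_combination α * h1 - n * h2 - B * hd

/-- The bound p < n m enters here: the graded piece of weight p involves at most one logarithmic
monomial, so the pull-back detects it. -/
theorem mem_weightForms_succ (hn : 0 < n) (hnm : n ≤ m) (hcop : Nat.Coprime n m) (hp : p < n * m)
    {η : Form} (hη : η ∈ weightForms n m p) (h : HasDivisorialOrderGE n m η (p + 1)) :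
    η ∈ weightForms n m (p + 1) := by
  by_cases hex : ∃ a b, p = n * a + m * b
  · obtain ⟨a, b, rfl⟩ := hex
    obtain ⟨A, B, hA, hB, hsub⟩ :=
      exists_sub_logForm_mem hn (hn.trans_le hnm) hcop hp hη
    have h1 := h.sub (hasDivisorialOrderGE_of_mem_weightForms hn hnm hcop hsub)
    rw [sub_sub_cancel] at h1
    obtain ⟨rfl, rfl⟩ := eq_zero_of_hasDivisorialOrderGE_logForm hn hnm hcop hA hB h1
    rwa [logForm_zero, sub_zero] at hsub
  · push Not at hex
    exact weightForms_le_succ hex hη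

theorem mem_weightForms_of_hasDivisorialOrderGE (hn : 0 < n) (hnm : n ≤ m) (hcop : Nat.Coprime n m)
    {η : Form} (hη : IsHolomorphicForm η) : ∀ {p : ℕ}, p ≤ n * m →
    HasDivisorialOrderGE n m η p → η ∈ weightForms n m p := by
  intro p
  induction p with
  | zero =>
    intro _ _
    have : ∀ p, η ∈ weightForms n m p → η ∈ weightForms n m 0 := by
      intro p
      induction p with
      | zero => exact id
      | succ p ih => exact fun h => ih (weightForms_succ_le h)
    exact this n (mem_weightForms_of_isHolomorphicForm hnm hη)
  | succ p ih =>
    intro hp h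
    exact mem_weightForms_succ hn hnm hcop hp (ih (by omega) (h.mono (by omega))) h

/-- The exponents in the supremum are downward closed, so a positive bound is witnessed by an
exponent above l - 1. For l = 0 one needs that the family is nonempty, which holomorphy provides. -/
theorem natCast_le_divisorialOrder (hn : 0 < n) (hnm : n ≤ m) (hcop : Nat.Coprime n m)
    {η : Form} (hη : IsHolomorphicForm η) {l : ℕ} :
    (l : ℕ∞) ≤ divisorialOrder n m η ↔ HasDivisorialOrderGE n m η l := by
  constructor
  · intro h
    rcases Nat.eq_zero_or_pos l with rfl | hl
    · exact (hasDivisorialOrderGE_of_mem_weightForms hn hnm hcop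
        (mem_weightForms_of_isHolomorphicForm hnm hη)).mono (Nat.zero_le n)
    · have h1 : ((l - 1 : ℕ) : ℕ∞) < divisorialOrder n m η :=
        lt_of_lt_of_le (by exact_mod_cast (by omega)) h
      obtain ⟨k, hk⟩ := lt_iSup_iff.1 h1
      obtain ⟨hk, hk'⟩ := lt_iSup_iff.1 hk
      have : l - 1 < k := by exact_mod_cast hk'
      exact hk.mono (by omega)
  · intro h
    exact le_iSup₂_of_le l h le_rfl

/-! ### Parametrizations of cusps and differential values -/

/-- The parametrization is `φ = (t ^ n X, t ^ m Y)`, with `t φ' = (t ^ n ξ, t ^ m ζ)`, where `X` and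
`Y` are units. -/
structure IsWeightedParam (n m : ℕ) (φ : ℂ → ℂ × ℂ) (X Y ξ ζ : ℂ → ℂ) : Prop where
  analyticAt_X : AnalyticAt ℂ X 0
  analyticAt_Y : AnalyticAt ℂ Y 0
  analyticAt_ξ : AnalyticAt ℂ ξ 0
  analyticAt_ζ : AnalyticAt ℂ ζ 0
  X_ne : X 0 ≠ 0
  Y_ne : Y 0 ≠ 0
  ξ_zero : ξ 0 = n * X 0
  ζ_zero : ζ 0 = m * Y 0
  eq : ∀ᶠ t in 𝓝 (0 : ℂ), φ t = (t ^ n * X t, t ^ m * Y t)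
  deriv_eq : ∀ᶠ t in 𝓝 (0 : ℂ), t • deriv φ t = (t ^ n * ξ t, t ^ m * ζ t)

theorem mul_deriv_pow_mul (k : ℕ) {X : ℂ → ℂ} {t : ℂ} (hX : DifferentiableAt ℂ X t) :
    ∃ d, HasDerivAt (fun t => t ^ k * X t) d t ∧ t * d = t ^ k * (k * X t + t * deriv X t) := by
  have h : HasDerivAt (fun t => t ^ k * X t) _ t := (hasDerivAt_pow k t).mul hX.hasDerivAt
  refine ⟨_, h, ?_⟩
  rcases k with _ | k
  · simp
  · simp only [Nat.add_sub_cancel]; ring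

theorem isWeightedParam_of_eq {φ : ℂ → ℂ × ℂ} {X Y : ℂ → ℂ} (hX : AnalyticAt ℂ X 0)
    (hY : AnalyticAt ℂ Y 0) (hX0 : X 0 ≠ 0) (hY0 : Y 0 ≠ 0)
    (h : φ =ᶠ[𝓝 0] fun t => (t ^ n * X t, t ^ m * Y t)) :
    IsWeightedParam n m φ X Y (fun t => n * X t + t * deriv X t)
      (fun t => m * Y t + t * deriv Y t) where
  analyticAt_X := hX
  analyticAt_Y := hY
  analyticAt_ξ := by fun_prop
  analyticAt_ζ := by fun_prop
  X_ne := hX0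
  Y_ne := hY0
  ξ_zero := by simp
  ζ_zero := by simp
  eq := h
  deriv_eq := by
    filter_upwards [h.deriv, hX.eventually_analyticAt, hY.eventually_analyticAt] with t h1 h2 h3
    obtain ⟨d, hd, hd'⟩ := mul_deriv_pow_mul n h2.differentiableAt
    obtain ⟨e, he, he'⟩ := mul_deriv_pow_mul m h3.differentiableAt
    rw [h1, (hd.prodMk he).deriv]
    ext
    · simpa using hd'
    · simpa using he'

/-- Since n ≥ 2, both α and β are nonzero, so v = 0 is also exceptional and freeness gives v ≠ 0 at
the point. Transversality gives u = t g(t) with g a unit; substituting in the monomial map yields X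
and Y. -/
theorem IsCusp.exists_isWeightedParam (hn : 2 ≤ n) (hnm : n ≤ m) (hcop : Nat.Coprime n m)
    {φ : ℂ → ℂ × ℂ} (hφ : IsCusp n m φ) : ∃ X Y ξ ζ, IsWeightedParam n m φ X Y ξ ζ := by
  obtain ⟨ψ, hψ, hφψ, hψ0, hψ', hfree⟩ := hφ
  obtain ⟨α, β, hdet, hπ⟩ := exists_cuspidalMap_eq (by omega) hnm hcop
  have hα : α ≠ 0 := by
    rintro rfl
    rcases hdet with h | h
    · have := Nat.eq_one_of_mul_eq_one_right (by simpa using h)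
      omega
    · simp at h
  have hβ : β ≠ 0 := by
    rintro rfl
    rcases hdet with h | h
    · simp at h
    · have := Nat.eq_one_of_mul_eq_one_right (by simpa using h)
      omega
  have hv : (ψ 0).2 ≠ 0 := by
    intro hv
    have h0 : ψ 0 = 0 := Prod.ext hψ0 hv
    rw [h0] at hfree
    have hγ : Tendsto (fun s : ℂ => (s, (0 : ℂ))) (𝓝 0) (𝓝 (0 : ℂ × ℂ)) := by
      have : ContinuousAt (fun s : ℂ => (s, (0 : ℂ))) 0 := by fun_prop
      simpa [ContinuousAt, Prod.zero_eq_mk] using this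
    have h1 := (hγ.eventually hfree).filter_mono (nhdsWithin_le_nhds (s := {0}ᶜ))
    obtain ⟨s, hs, hs0⟩ := (h1.and self_mem_nhdsWithin).exists
    exact hs0 (hs (by rw [hπ]; simp [hα, hβ]))
  have ha : AnalyticAt ℂ (fun t => (ψ t).1) 0 :=
    ((ContinuousLinearMap.fst ℂ ℂ ℂ).analyticAt _).comp hψ
  have hb : AnalyticAt ℂ (fun t => (ψ t).2) 0 :=
    ((ContinuousLinearMap.snd ℂ ℂ ℂ).analyticAt _).comp hψ
  have hd : deriv (fun t => (ψ t).1) 0 ≠ 0 := by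
    have : HasDerivAt (fun t => (ψ t).1) (deriv ψ 0).1 0 :=
      (ContinuousLinearMap.fst ℂ ℂ ℂ).hasFDerivAt.comp_hasDerivAt 0
        hψ.differentiableAt.hasDerivAt
    rwa [this.deriv]
  have hord := ha.analyticOrderAt_eq_one_of_zero_deriv_ne_zero hψ0 hd
  rw [← Nat.cast_one, ha.analyticOrderAt_eq_natCast] at hord
  obtain ⟨g, hg, hg0, hgeq⟩ := hord
  refine ⟨fun t => g t ^ n * (ψ t).2 ^ α, fun t => g t ^ m * (ψ t).2 ^ β, _, _,
    isWeightedParam_of_eq ((hg.pow n).mul (hb.pow α)) ((hg.pow m).mul (hb.pow β)) (by positivity)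
      (by positivity) ?_⟩
  filter_upwards [hφψ, hgeq] with t h1 h2
  rw [h1, Function.comp, hπ, h2]
  simp only [sub_zero, pow_one, smul_eq_mul]
  ext <;> simp only [mul_pow] <;> ring

/-- The function `a(t)` with `φ^* η = a(t) dt / t`. -/
def along (φ : ℂ → ℂ × ℂ) (η : Form) : ℂ → ℂ := fun t => t * η (φ t) (deriv φ t)

theorem along_add (φ : ℂ → ℂ × ℂ) (η θ : Form) : along φ (η + θ) = along φ η + along φ θ := by
  funext t; simp [along, mul_add]

theorem along_smul (φ : ℂ → ℂ × ℂ) (μ : ℂ) (η : Form) : along φ (μ • η) = μ • along φ η := by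
  funext t; simp only [along, Pi.smul_apply, smul_apply, smul_eq_mul]; ring

theorem along_apply (φ : ℂ → ℂ × ℂ) (η : Form) (t : ℂ) :
    along φ η t = η (φ t) (t • deriv φ t) := by
  simp [along]

theorem analyticOrderAt_pow_mul {f g : ℂ → ℂ} (hg : AnalyticAt ℂ g 0)
    (h : f =ᶠ[𝓝 0] fun t => t ^ p * g t) : analyticOrderAt f 0 = p + analyticOrderAt g 0 := by
  have hpow : analyticOrderAt (fun t : ℂ => t ^ p) 0 = p := by
    rw [AnalyticAt.analyticOrderAt_eq_natCast (by fun_prop)]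
    exact ⟨fun _ => 1, by fun_prop, by simp, by simp⟩
  rw [analyticOrderAt_congr h, ← hpow]
  exact analyticOrderAt_mul (by fun_prop) hg

theorem lt_analyticOrderAt_pow_mul {f g : ℂ → ℂ} (hg : AnalyticAt ℂ g 0)
    (h : f =ᶠ[𝓝 0] fun t => t ^ p * g t) : (p : ℕ∞) < analyticOrderAt f 0 ↔ g 0 = 0 := by
  rw [analyticOrderAt_pow_mul hg h, ← hg.analyticOrderAt_ne_zero]
  constructor
  · rintro h h0
    simp [h0] at h
  · intro h0
    rw [← ENat.add_one_le_iff (ENat.natCast_ne_top p)]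
    gcongr
    exact Order.one_le_iff_ne_zero.2 h0

namespace IsWeightedParam

variable {φ : ℂ → ℂ × ℂ} {X Y ξ ζ : ℂ → ℂ}

theorem analyticAt (h : IsWeightedParam n m φ X Y ξ ζ) : AnalyticAt ℂ φ 0 := by
  have h1 := h.analyticAt_X
  have h2 := h.analyticAt_Y
  have h3 : AnalyticAt ℂ (fun t => (t ^ n * X t, t ^ m * Y t)) 0 := by fun_prop
  exact h3.congr (EventuallyEq.symm h.eq)

theorem apply_zero (h : IsWeightedParam n m φ X Y ξ ζ) (hn : 0 < n) (hm : 0 < m) : φ 0 = 0 := by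
  rw [h.eq.self_of_nhds]; simp [hn.ne', hm.ne']

theorem along_eq (h : IsWeightedParam n m φ X Y ξ ζ) (η : Form) :
    along φ η =ᶠ[𝓝 0] fun t => t ^ n * ξ t * η (φ t) (1, 0) + t ^ m * ζ t * η (φ t) (0, 1) := by
  filter_upwards [h.deriv_eq] with t ht
  rw [along_apply, ht]
  have e : (t ^ n * ξ t, t ^ m * ζ t) =
      (t ^ n * ξ t) • ((1 : ℂ), (0 : ℂ)) + (t ^ m * ζ t) • ((0 : ℂ), (1 : ℂ)) := by
    ext <;> simp
  rw [e, map_add, map_smul, map_smul]; simp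

theorem analyticAt_along (h : IsWeightedParam n m φ X Y ξ ζ) (hn : 0 < n) (hm : 0 < m) {η : Form}
    (hη : IsHolomorphicForm η) : AnalyticAt ℂ (along φ η) 0 := by
  have hη' : AnalyticAt ℂ (fun t => η (φ t)) 0 := by
    have h1 : AnalyticAt ℂ η (φ 0) := by rw [h.apply_zero hn hm]; exact hη
    exact h1.comp h.analyticAt
  have h1 := analyticAt_clm_apply_const hη' (1, 0)
  have h2 := analyticAt_clm_apply_const hη' (0, 1)
  have h3 := h.analyticAt_ξ
  have h4 := h.analyticAt_ζ
  have h5 : AnalyticAt ℂ (fun t => t ^ n * ξ t) 0 := by fun_prop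
  have h6 : AnalyticAt ℂ (fun t => t ^ m * ζ t) 0 := by fun_prop
  exact ((h5.mul h1).add (h6.mul h2)).congr (h.along_eq η).symm

theorem exists_along_eq_pow_mul (h : IsWeightedParam n m φ X Y ξ ζ) (hn : 0 < n) (hm : 0 < m)
    {η : Form} (hη : η ∈ weightForms n m p) :
    ∃ g, AnalyticAt ℂ g 0 ∧ along φ η =ᶠ[𝓝 0] fun t => t ^ p * g t := by
  have hX := h.analyticAt_X
  have hY := h.analyticAt_Y
  have hξ := h.analyticAt_ξ
  have hζ := h.analyticAt_ζ
  have ht : Tendsto φ (𝓝 0) (𝓝 0) := by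
    simpa [ContinuousAt, h.apply_zero hn hm] using h.analyticAt.continuousAt
  induction hη using Submodule.span_induction with
  | mem η hη =>
    obtain ⟨a, b, k, hk, ⟨h1, h2⟩ | ⟨h1, h2⟩⟩ := hη
    · obtain ⟨d, hd⟩ := Nat.exists_eq_add_of_le h1
      have hkφ : AnalyticAt ℂ (fun t => k (φ t)) 0 := by
        rw [← h.apply_zero hn hm] at hk; exact hk.comp h.analyticAt
      have hM : AnalyticAt ℂ (fun t => t ^ d * (X t ^ a * Y t ^ b * ξ t)) 0 := by fun_prop
      refine ⟨fun t => t ^ d * (X t ^ a * Y t ^ b * ξ t) * k (φ t), hM.mul hkφ, ?_⟩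
      filter_upwards [h.along_eq η, ht.eventually h2, h.eq] with t h3 h4 h5
      have e : t ^ p * t ^ d = t ^ (n * (a + 1) + m * b) := by rw [hd, pow_add]
      rw [h3, h4, ← mul_assoc, ← mul_assoc, e]
      simp only [formDx, smul_apply, ContinuousLinearMap.coe_fst', smul_eq_mul, mul_one, mul_zero,
        add_zero]
      rw [congrArg Prod.fst h5, congrArg Prod.snd h5]
      ring
    · obtain ⟨d, hd⟩ := Nat.exists_eq_add_of_le h1
      have hkφ : AnalyticAt ℂ (fun t => k (φ t)) 0 := by
        rw [← h.apply_zero hn hm] at hk; exact hk.comp h.analyticAt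
      have hM : AnalyticAt ℂ (fun t => t ^ d * (X t ^ a * Y t ^ b * ζ t)) 0 := by fun_prop
      refine ⟨fun t => t ^ d * (X t ^ a * Y t ^ b * ζ t) * k (φ t), hM.mul hkφ, ?_⟩
      filter_upwards [h.along_eq η, ht.eventually h2, h.eq] with t h3 h4 h5
      have e : t ^ p * t ^ d = t ^ (n * a + m * (b + 1)) := by rw [hd, pow_add]
      rw [h3, h4, ← mul_assoc, ← mul_assoc, e]
      simp only [formDy, smul_apply, ContinuousLinearMap.coe_snd', smul_eq_mul, mul_one, mul_zero,
        zero_add]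
      rw [congrArg Prod.fst h5, congrArg Prod.snd h5]
      ring
  | zero => exact ⟨0, analyticAt_const, .of_forall fun t => by simp [along]⟩
  | add η θ _ _ h1 h2 =>
    obtain ⟨g, hg, hg'⟩ := h1
    obtain ⟨k, hk, hk'⟩ := h2
    refine ⟨g + k, hg.add hk, ?_⟩
    filter_upwards [hg', hk'] with t h3 h4
    rw [along_add, Pi.add_apply, h3, h4, Pi.add_apply, mul_add]
  | smul μ η _ h1 =>
    obtain ⟨g, hg, hg'⟩ := h1
    refine ⟨fun t => μ * g t, analyticAt_const.mul hg, ?_⟩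
    filter_upwards [hg'] with t h3
    rw [along_smul, Pi.smul_apply, h3, smul_eq_mul, mul_left_comm]

theorem le_diffValue (h : IsWeightedParam n m φ X Y ξ ζ) (hn : 0 < n) (hm : 0 < m) {η : Form}
    (hη : η ∈ weightForms n m p) : (p : ℕ∞) ≤ diffValue φ η := by
  obtain ⟨g, hg, hg'⟩ := h.exists_along_eq_pow_mul hn hm hη
  have h1 : diffValue φ η = p + analyticOrderAt g 0 := analyticOrderAt_pow_mul hg hg'
  rw [h1]; exact le_self_add

theorem along_logForm (h : IsWeightedParam n m φ X Y ξ ζ) {a b : ℕ} {A B : ℂ}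
    (ha : a = 0 → A = 0) (hb : b = 0 → B = 0) :
    ∃ g, AnalyticAt ℂ g 0 ∧ g 0 = (n * A + m * B) * (X 0 ^ a * Y 0 ^ b) ∧
      along φ (logForm a b A B) =ᶠ[𝓝 0] fun t => t ^ (n * a + m * b) * g t := by
  have hX := h.analyticAt_X
  have hY := h.analyticAt_Y
  have hξ := h.analyticAt_ξ
  have hζ := h.analyticAt_ζ
  refine ⟨fun t => A * X t ^ (a - 1) * Y t ^ b * ξ t + B * X t ^ a * Y t ^ (b - 1) * ζ t,
    by fun_prop, ?_, ?_⟩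
  · have h1 : A * X 0 ^ (a - 1) * Y 0 ^ b * (n * X 0) = n * A * (X 0 ^ a * Y 0 ^ b) := by
      rcases a with _ | a
      · simp [ha]
      · simp only [Nat.add_sub_cancel]; ring
    have h2 : B * X 0 ^ a * Y 0 ^ (b - 1) * (m * Y 0) = m * B * (X 0 ^ a * Y 0 ^ b) := by
      rcases b with _ | b
      · simp [hb]
      · simp only [Nat.add_sub_cancel]; ring
    simp only [h.ξ_zero, h.ζ_zero, h1, h2]; ring
  · filter_upwards [h.along_eq (logForm a b A B), h.eq] with t h1 h2
    rw [h1, h2]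
    simp only [logForm, formDx, formDy, Pi.add_apply, add_apply, smul_apply, smul_eq_mul,
      ContinuousLinearMap.coe_fst', ContinuousLinearMap.coe_snd', mul_one, mul_zero, add_zero,
      zero_add]
    have h3 : t ^ n * ξ t * (A * ((t ^ n * X t) ^ (a - 1) * (t ^ m * Y t) ^ b)) =
        t ^ (n * a + m * b) * (A * X t ^ (a - 1) * Y t ^ b * ξ t) := by
      rcases a with _ | a
      · simp [ha]
      · simp only [Nat.add_sub_cancel]; ring
    have h4 : t ^ m * ζ t * (B * ((t ^ n * X t) ^ a * (t ^ m * Y t) ^ (b - 1))) =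
        t ^ (n * a + m * b) * (B * X t ^ a * Y t ^ (b - 1) * ζ t) := by
      rcases b with _ | b
      · simp [hb]
      · simp only [Nat.add_sub_cancel]; ring
    rw [h3, h4, mul_add]

/-- A form is resonant exactly when its differential value exceeds the weight of its initial part. -/
theorem lt_diffValue_iff (h : IsWeightedParam n m φ X Y ξ ζ) (hn : 0 < n) (hm : 0 < m) {a b : ℕ}
    {A B : ℂ} (ha : a = 0 → A = 0) (hb : b = 0 → B = 0) {η : Form}
    (hη : η - logForm a b A B ∈ weightForms n m (n * a + m * b + 1)) :
    ((n * a + m * b : ℕ) : ℕ∞) < diffValue φ η ↔ (n * A + m * B : ℂ) = 0 := by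
  obtain ⟨g, hg, hg0, hgeq⟩ := h.along_logForm ha hb
  obtain ⟨k, hk, hkeq⟩ := h.exists_along_eq_pow_mul hn hm hη
  have h1 : AnalyticAt ℂ (fun t => g t + t * k t) 0 := by fun_prop
  have h2 : along φ η =ᶠ[𝓝 0] fun t => t ^ (n * a + m * b) * (g t + t * k t) := by
    filter_upwards [hgeq, hkeq] with t h3 h4
    have h5 : along φ η = along φ (logForm a b A B) + along φ (η - logForm a b A B) := by
      rw [← along_add]; congr 1; abel
    rw [h5, Pi.add_apply, h3, h4]; ring
  refine (lt_analyticOrderAt_pow_mul h1 h2).trans ?_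
  have hX := h.X_ne
  have hY := h.Y_ne
  simp [hg0, hX, hY]

theorem diffValue_monomialMul (h : IsWeightedParam n m φ X Y ξ ζ) (hn : 0 < n) (hm : 0 < m)
    {η : Form} (hη : IsHolomorphicForm η) (a b : ℕ) :
    diffValue φ (monomialMul a b η) = diffValue φ η + ((n * a + m * b : ℕ) : ℕ∞) := by
  have hX := h.analyticAt_X
  have hY := h.analyticAt_Y
  have hU : AnalyticAt ℂ (fun t => X t ^ a * Y t ^ b) 0 := by fun_prop
  have hU0 : analyticOrderAt (fun t => X t ^ a * Y t ^ b) 0 = 0 := by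
    rw [hU.analyticOrderAt_eq_zero]
    have h1 := h.X_ne
    have h2 := h.Y_ne
    positivity
  have hη' := h.analyticAt_along hn hm hη
  have h1 : along φ (monomialMul a b η) =ᶠ[𝓝 0]
      fun t => t ^ (n * a + m * b) * ((X t ^ a * Y t ^ b) * along φ η t) := by
    filter_upwards [h.eq] with t ht
    simp only [along, monomialMul, smul_apply, smul_eq_mul, ht]; ring
  have h2 := analyticOrderAt_pow_mul (hU.mul hη') h1
  have h3 : analyticOrderAt ((fun t => X t ^ a * Y t ^ b) * along φ η) 0 =
      0 + analyticOrderAt (along φ η) 0 := by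
    rw [← hU0]; exact analyticOrderAt_mul hU hη'
  rw [add_comm]
  exact h2.trans (by rw [h3, zero_add]; rfl)

end IsWeightedParam

theorem le_diffValue_add (φ : ℂ → ℂ × ℂ) (η θ : Form) :
    min (diffValue φ η) (diffValue φ θ) ≤ diffValue φ (η + θ) := by
  have h := le_analyticOrderAt_add (f := along φ η) (g := along φ θ) (z₀ := 0)
  rw [← along_add] at h
  exact h

theorem le_diffValue_smul {φ : ℂ → ℂ × ℂ} {η : Form} (hη : AnalyticAt ℂ (along φ η) 0) (μ : ℂ) :
    diffValue φ η ≤ diffValue φ (μ • η) := by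
  have h : analyticOrderAt (along φ (μ • η)) 0 = analyticOrderAt (fun _ : ℂ => μ) 0 +
      analyticOrderAt (along φ η) 0 := by
    rw [along_smul]; exact analyticOrderAt_mul analyticAt_const hη
  exact (h ▸ le_add_self : analyticOrderAt (along φ η) 0 ≤ analyticOrderAt (along φ (μ • η)) 0)

theorem exists_lt_diffValue_sub_smul {φ : ℂ → ℂ × ℂ} {η θ : Form} {k : ℕ}
    (hη : AnalyticAt ℂ (along φ η) 0) (hθ : AnalyticAt ℂ (along φ θ) 0)
    (h : diffValue φ η = k) (h' : diffValue φ θ = k) :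
    ∃ μ : ℂ, (k : ℕ∞) < diffValue φ (η - μ • θ) := by
  obtain ⟨f, hf, -, hf'⟩ := hη.analyticOrderAt_eq_natCast.1 h
  obtain ⟨g, hg, hg0, hg'⟩ := hθ.analyticOrderAt_eq_natCast.1 h'
  refine ⟨f 0 / g 0, ?_⟩
  have h1 : AnalyticAt ℂ (fun t => f t - f 0 / g 0 * g t) 0 :=
    hf.sub (analyticAt_const.mul hg)
  refine (lt_analyticOrderAt_pow_mul h1 (f := along φ (η - (f 0 / g 0) • θ)) ?_).2 (by field_simp; simp)
  filter_upwards [hf', hg'] with t h2 h3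
  have h4 : η - (f 0 / g 0) • θ = η + (-(f 0 / g 0)) • θ := by module
  rw [h4, along_add, along_smul, Pi.add_apply, Pi.smul_apply, h2, h3]
  simp only [sub_zero, smul_eq_mul]; ring

/-! ### The two orders on the space of holomorphic forms -/

/-- A non-archimedean order function on a complex vector space. -/
structure IsOrder {V : Type*} [AddCommGroup V] [Module ℂ V] (ν : V → ℕ∞) : Prop where
  add : ∀ η θ, min (ν η) (ν θ) ≤ ν (η + θ)
  smul : ∀ (μ : ℂ) η, ν η ≤ ν (μ • η)

namespace IsOrder

variable {V : Type*} [AddCommGroup V] [Module ℂ V] {ν : V → ℕ∞}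

theorem sub_smul (h : IsOrder ν) (η θ : V) (μ : ℂ) : min (ν η) (ν θ) ≤ ν (η - μ • θ) := by
  have e : η - μ • θ = η + (-μ) • θ := by module
  rw [e]
  exact (min_le_min le_rfl (h.smul _ _)).trans (h.add _ _)

theorem sub_smul_of_lt (h : IsOrder ν) {η θ : V} (hlt : ν η < ν θ) (μ : ℂ) :
    ν (η - μ • θ) = ν η := by
  refine le_antisymm ?_ (by simpa [hlt.le] using h.sub_smul η θ μ)
  have h1 := h.sub_smul (η - μ • θ) θ (-μ)
  have e : η - μ • θ - (-μ) • θ = η := by module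
  rw [e] at h1
  rcases min_le_iff.1 h1 with h1 | h1
  · exact h1
  · exact absurd h1 hlt.not_ge

theorem sub_smul_of_gt (h : IsOrder ν) {η θ : V} (hlt : ν θ < ν η) {μ : ℂ} (hμ : μ ≠ 0) :
    ν (η - μ • θ) = ν θ := by
  refine le_antisymm ?_ (by simpa [hlt.le] using h.sub_smul η θ μ)
  have h1 := h.sub_smul (μ⁻¹ • η) (η - μ • θ) μ⁻¹
  have e : μ⁻¹ • η - μ⁻¹ • (η - μ • θ) = θ := by
    rw [smul_sub, smul_smul, inv_mul_cancel₀ hμ]; module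
  rw [e] at h1
  rcases min_le_iff.1 h1 with h1 | h1
  · exact absurd ((h.smul μ⁻¹ η).trans h1) hlt.not_ge
  · exact h1

end IsOrder

/-- The properties relating the differential value `c` and the divisorial order `e`. -/
structure IsOrderPair (n m : ℕ) {V : Type*} [AddCommGroup V] [Module ℂ V]
    (mon : ℕ → ℕ → V → V) (c e : V → ℕ∞) : Prop where
  isOrder_c : IsOrder c
  isOrder_e : IsOrder e
  c_mon : ∀ a b η, c (mon a b η) = c η + ((n * a + m * b : ℕ) : ℕ∞)
  e_mon : ∀ a b η (p : ℕ), e η = p → p < n * m → e (mon a b η) = ((p + (n * a + m * b) : ℕ) : ℕ∞)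
  cancel : ∀ η θ (k : ℕ), c η = k → c θ = k → ∃ μ : ℂ, (k : ℕ∞) < c (η - μ • θ)
  le_c : ∀ η (p : ℕ), (p : ℕ∞) ≤ e η → p ≤ n * m → (p : ℕ∞) ≤ c η
  resonant : ∀ η θ (p : ℕ), e η = p → e θ = p → p < n * m → (p : ℕ∞) < c η → (p : ℕ∞) < c θ →
    ∃ μ : ℂ, (p : ℕ∞) < e (η - μ • θ)
  e_eq_of_lt : ∀ η (p : ℕ), e η = p → p < n * m → (p : ℕ∞) < c η →
    ∃ a b, p = n + m + (n * a + m * b)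
  e_mem : ∀ η (p : ℕ), e η = p → p < n * m → n ≤ p ∧ ∃ a b, p = n * a + m * b
  exists_c_eq_left : ∃ η, c η = n
  exists_c_eq_right : ∃ η, c η = m
  exists_resonant : ∃ η, e η = ((n + m : ℕ) : ℕ∞) ∧ ((n + m : ℕ) : ℕ∞) < c η

/-- The space of holomorphic forms. -/
def holomorphicForms : Submodule ℂ Form where
  carrier := {η | IsHolomorphicForm η}
  zero_mem' := analyticAt_const
  add_mem' := fun h h' => AnalyticAt.add h h'
  smul_mem' := fun μ _ h => AnalyticAt.const_smul (c := μ) h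

theorem IsHolomorphicForm.monomialMul {η : Form} (h : IsHolomorphicForm η) (a b : ℕ) :
    IsHolomorphicForm (monomialMul a b η) :=
  AnalyticAt.smul ((analyticAt_fst.pow a).mul (analyticAt_snd.pow b)) h

/-- Multiplication of holomorphic forms by `x ^ a y ^ b`. -/
def monomialMulHol (a b : ℕ) (η : holomorphicForms) : holomorphicForms :=
  ⟨monomialMul a b η.1, IsHolomorphicForm.monomialMul η.2 a b⟩

theorem isHolomorphicForm_logForm (a b : ℕ) (A B : ℂ) : IsHolomorphicForm (logForm a b A B) :=
  AnalyticAt.add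
    (AnalyticAt.smul (analyticAt_const.mul ((analyticAt_fst.pow _).mul (analyticAt_snd.pow _)))
      analyticAt_const)
    (AnalyticAt.smul (analyticAt_const.mul ((analyticAt_fst.pow _).mul (analyticAt_snd.pow _)))
      analyticAt_const)

theorem monomialMul_sub (a b : ℕ) (η θ : Form) :
    monomialMul a b (η - θ) = monomialMul a b η - monomialMul a b θ := by
  funext z; simp [monomialMul, smul_sub]

theorem monomialMul_logForm {a b a' b' : ℕ} {A B : ℂ} (ha : a' = 0 → A = 0) (hb : b' = 0 → B = 0) :
    monomialMul a b (logForm a' b' A B) = logForm (a + a') (b + b') A B := by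
  funext z
  have h1 : z.1 ^ a * z.2 ^ b * (A * (z.1 ^ (a' - 1) * z.2 ^ b')) =
      A * (z.1 ^ (a + a' - 1) * z.2 ^ (b + b')) := by
    rcases a' with _ | a'
    · simp [ha]
    · rw [← add_assoc]; simp only [Nat.add_sub_cancel]; ring
  have h2 : z.1 ^ a * z.2 ^ b * (B * (z.1 ^ a' * z.2 ^ (b' - 1))) =
      B * (z.1 ^ (a + a') * z.2 ^ (b + b' - 1)) := by
    rcases b' with _ | b'
    · simp [hb]
    · rw [← add_assoc]; simp only [Nat.add_sub_cancel]; ring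
  simp only [monomialMul, logForm, formDx, formDy, Pi.add_apply, smul_add, smul_smul, h1, h2]

/-! ### Cusps satisfy the axioms of an order pair -/

section

variable {n m : ℕ}

theorem divisorialOrder_eq_natCast (hn : 0 < n) (hnm : n ≤ m) (hcop : Nat.Coprime n m)
    {η : Form} (hη : IsHolomorphicForm η) {p : ℕ}
    (h : HasDivisorialOrderGE n m η p) (h' : ¬ HasDivisorialOrderGE n m η (p + 1)) :
    divisorialOrder n m η = p := by
  rw [← natCast_le_divisorialOrder hn hnm hcop hη] at h h'
  refine le_antisymm ?_ h
  by_contra h2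
  refine h' ?_
  push_cast
  exact (ENat.add_one_le_iff (ENat.natCast_ne_top p)).2 (not_le.1 h2)

/-- The initial part of a form of divisorial order less than `n m`. -/
theorem exists_initialPart (hn : 0 < n) (hnm : n ≤ m) (hcop : Nat.Coprime n m)
    {η : Form} (hη : IsHolomorphicForm η) {p : ℕ}
    (hp : p < n * m) (he : divisorialOrder n m η = p) :
    ∃ (a b : ℕ) (A B : ℂ), p = n * a + m * b ∧ (a = 0 → A = 0) ∧ (b = 0 → B = 0) ∧
      ¬ (A = 0 ∧ B = 0) ∧ η - logForm a b A B ∈ weightForms n m (n * a + m * b + 1) := by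
  have h1 : η ∈ weightForms n m p := mem_weightForms_of_hasDivisorialOrderGE hn hnm hcop hη hp.le
    ((natCast_le_divisorialOrder hn hnm hcop hη).1 he.ge)
  have h2 : η ∉ weightForms n m (p + 1) := by
    intro h
    have h3 := (natCast_le_divisorialOrder hn hnm hcop hη).2
      (hasDivisorialOrderGE_of_mem_weightForms hn hnm hcop h)
    rw [he] at h3
    have : p + 1 ≤ p := by exact_mod_cast h3
    omega
  by_cases hex : ∃ a b, p = n * a + m * b
  · obtain ⟨a, b, rfl⟩ := hex
    obtain ⟨A, B, hA, hB, hsub⟩ := exists_sub_logForm_mem hn (hn.trans_le hnm) hcop hp h1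
    refine ⟨a, b, A, B, rfl, hA, hB, ?_, hsub⟩
    rintro ⟨rfl, rfl⟩
    rw [logForm_zero, sub_zero] at hsub
    exact h2 hsub
  · push Not at hex
    exact absurd (weightForms_le_succ hex h1) h2

theorem divisorialOrder_eq_of_initialPart (hn : 0 < n) (hnm : n ≤ m) (hcop : Nat.Coprime n m)
    {η : Form} (hη : IsHolomorphicForm η) {a b : ℕ}
    {A B : ℂ} (hA : a = 0 → A = 0) (hB : b = 0 → B = 0) (hAB : ¬ (A = 0 ∧ B = 0))
    (h : η - logForm a b A B ∈ weightForms n m (n * a + m * b + 1)) :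
    divisorialOrder n m η = ((n * a + m * b : ℕ) : ℕ∞) := by
  refine divisorialOrder_eq_natCast hn hnm hcop hη ?_ ?_
  · have h1 := add_mem (weightForms_succ_le h) (logForm_mem_weightForms (n := n) (m := m) hA hB)
    rw [sub_add_cancel] at h1
    exact hasDivisorialOrderGE_of_mem_weightForms hn hnm hcop h1
  · intro h1
    have h2 := h1.sub (hasDivisorialOrderGE_of_mem_weightForms hn hnm hcop h)
    rw [sub_sub_cancel] at h2
    exact hAB (eq_zero_of_hasDivisorialOrderGE_logForm hn hnm hcop hA hB h2)

theorem isOrder_divisorialOrder (hn : 0 < n) (hnm : n ≤ m) (hcop : Nat.Coprime n m) :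
    IsOrder fun η : holomorphicForms => divisorialOrder n m η.1 where
  add η θ := by
    refine ENat.forall_natCast_le_iff_le.1 fun k hk => ?_
    rw [le_min_iff, natCast_le_divisorialOrder hn hnm hcop η.2,
      natCast_le_divisorialOrder hn hnm hcop θ.2] at hk
    exact (natCast_le_divisorialOrder hn hnm hcop (η + θ).2).2 (hk.1.add hk.2)
  smul μ η := by
    refine ENat.forall_natCast_le_iff_le.1 fun k hk => ?_
    rw [natCast_le_divisorialOrder hn hnm hcop η.2] at hk
    exact (natCast_le_divisorialOrder hn hnm hcop (μ • η).2).2 (hk.smul μ)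

theorem diffValue_logForm (hn : 0 < n) (hnm : n ≤ m)
    {φ : ℂ → ℂ × ℂ} {X Y ξ ζ : ℂ → ℂ} (h : IsWeightedParam n m φ X Y ξ ζ)
    {a b : ℕ} {A B : ℂ} (hA : a = 0 → A = 0) (hB : b = 0 → B = 0) (hne : (n * A + m * B : ℂ) ≠ 0) :
    diffValue φ (logForm a b A B) = ((n * a + m * b : ℕ) : ℕ∞) := by
  have hm := hn.trans_le hnm
  refine le_antisymm ?_ (h.le_diffValue hn hm (logForm_mem_weightForms hA hB))
  rw [← not_lt, h.lt_diffValue_iff hn hm hA hB (by rw [sub_self]; exact zero_mem _)]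
  exact hne

theorem IsWeightedParam.isOrderPair (hn : 0 < n) (hnm : n ≤ m) (hcop : Nat.Coprime n m)
    {φ : ℂ → ℂ × ℂ} {X Y ξ ζ : ℂ → ℂ}
    (h : IsWeightedParam n m φ X Y ξ ζ) :
    IsOrderPair n m monomialMulHol (fun η : holomorphicForms => diffValue φ η.1)
      (fun η : holomorphicForms => divisorialOrder n m η.1) := by
  have hm : 0 < m := hn.trans_le hnm
  have hn' : (n : ℂ) ≠ 0 := by exact_mod_cast hn.ne'
  have hm' : (m : ℂ) ≠ 0 := by exact_mod_cast hm.ne'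
  constructor
  case isOrder_c =>
    exact ⟨fun η θ => le_diffValue_add φ η.1 θ.1,
      fun μ η => le_diffValue_smul (h.analyticAt_along hn hm η.2) μ⟩
  case isOrder_e => exact isOrder_divisorialOrder hn hnm hcop
  case c_mon => exact fun a b η => h.diffValue_monomialMul hn hm η.2 a b
  case e_mon =>
    intro a b η p he hp
    obtain ⟨a', b', A, B, rfl, hA, hB, hAB, hsub⟩ := exists_initialPart hn hnm hcop η.2 hp he
    have h1 := monomialMul_mem_weightForms a b hsub
    rw [monomialMul_sub, monomialMul_logForm hA hB] at h1
    have e1 : n * a' + m * b' + 1 + (n * a + m * b) = n * (a + a') + m * (b + b') + 1 := by ring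
    have e2 : n * a' + m * b' + (n * a + m * b) = n * (a + a') + m * (b + b') := by ring
    rw [e1] at h1
    rw [e2]
    exact divisorialOrder_eq_of_initialPart hn hnm hcop (η.2.monomialMul a b)
      (fun h => hA (by omega)) (fun h => hB (by omega)) hAB h1
  case cancel =>
    exact fun η θ k h1 h2 => exists_lt_diffValue_sub_smul (h.analyticAt_along hn hm η.2)
      (h.analyticAt_along hn hm θ.2) h1 h2
  case le_c =>
    exact fun η p h1 h2 => h.le_diffValue hn hm (mem_weightForms_of_hasDivisorialOrderGE hn hnm hcop
      η.2 h2 ((natCast_le_divisorialOrder hn hnm hcop η.2).1 h1))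
  case resonant =>
    intro η θ p he he' hp hc hc'
    obtain ⟨a, b, A, B, rfl, hA, hB, hAB, hsub⟩ := exists_initialPart hn hnm hcop η.2 hp he
    obtain ⟨a', b', A', B', hab, hA', hB', hAB', hsub'⟩ :=
      exists_initialPart hn hnm hcop θ.2 hp he'
    obtain ⟨rfl, rfl⟩ := weight_injective hcop hp hab
    have h1 := (h.lt_diffValue_iff hn hm hA hB hsub).1 hc
    have h2 := (h.lt_diffValue_iff hn hm hA' hB' hsub').1 hc'
    have hA0 : A' ≠ 0 := by
      rintro rfl
      refine hAB' ⟨rfl, ?_⟩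
      simpa [hm'] using h2
    -- Both (A, B) and (A', B') lie on the line n A + m B = 0, so they are proportional.
    refine ⟨A / A', ?_⟩
    have e1 : A / A' * A' = A := by field_simp
    have e2 : A / A' * B' = B := by
      refine mul_left_cancel₀ hm' ?_
      linear_combination (A / A') * h2 - h1 - n * e1
    have h3 := sub_mem hsub (Submodule.smul_mem _ (A / A') hsub')
    rw [smul_sub, ← logForm_smul, e1, e2, sub_sub_sub_cancel_right] at h3
    have h4 := (natCast_le_divisorialOrder hn hnm hcop (η - (A / A') • θ).2).2
      (hasDivisorialOrderGE_of_mem_weightForms hn hnm hcop h3)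
    exact lt_of_lt_of_le (by exact_mod_cast Nat.lt_succ_self _) h4
  case e_eq_of_lt =>
    intro η p he hp hc
    obtain ⟨a, b, A, B, rfl, hA, hB, hAB, hsub⟩ := exists_initialPart hn hnm hcop η.2 hp he
    have h1 := (h.lt_diffValue_iff hn hm hA hB hsub).1 hc
    -- With a = 0 or b = 0 only one coefficient survives, and the resonance relation kills it. So x
    -- y divides the monomial, whence the summand n + m.
    have ha : a ≠ 0 := by
      intro ha
      rw [hA ha] at h1
      exact hAB ⟨hA ha, by simpa [hm'] using h1⟩
    have hb : b ≠ 0 := by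
      intro hb
      rw [hB hb] at h1
      exact hAB ⟨by simpa [hn'] using h1, hB hb⟩
    obtain ⟨a, rfl⟩ := Nat.exists_eq_succ_of_ne_zero ha
    obtain ⟨b, rfl⟩ := Nat.exists_eq_succ_of_ne_zero hb
    exact ⟨a, b, by simp only [Nat.succ_eq_add_one]; ring⟩
  case e_mem =>
    intro η p he hp
    obtain ⟨a, b, A, B, hab, -⟩ := exists_initialPart hn hnm hcop η.2 hp he
    refine ⟨?_, a, b, hab⟩
    have h1 := (natCast_le_divisorialOrder hn hnm hcop η.2).2
      (hasDivisorialOrderGE_of_mem_weightForms hn hnm hcop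
        (mem_weightForms_of_isHolomorphicForm hnm η.2))
    exact_mod_cast h1.trans_eq he
  case exists_c_eq_left =>
    refine ⟨⟨logForm 1 0 1 0, isHolomorphicForm_logForm _ _ _ _⟩, ?_⟩
    simpa using diffValue_logForm hn hnm h (a := 1) (b := 0) (A := 1) (B := 0) (by simp)
      (by simp) (by simpa using hn.ne')
  case exists_c_eq_right =>
    refine ⟨⟨logForm 0 1 0 1, isHolomorphicForm_logForm _ _ _ _⟩, ?_⟩
    simpa using diffValue_logForm hn hnm h (a := 0) (b := 1) (A := 0) (B := 1) (by simp)
      (by simp) (by simpa using hm.ne')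
  case exists_resonant =>
    -- This is m y dx - n x dy, which is x y times the logarithmic differential of x^m / y^n.
    refine ⟨⟨logForm 1 1 m (-n), isHolomorphicForm_logForm _ _ _ _⟩, ?_, ?_⟩
    · simpa using divisorialOrder_eq_of_initialPart hn hnm hcop
        (a := 1) (b := 1) (A := m) (B := -n)
        (isHolomorphicForm_logForm 1 1 m (-n)) (by simp) (by simp) (by simp [hn.ne'])
        (by rw [sub_self]; exact zero_mem _)
    · have := (h.lt_diffValue_iff hn hm (a := 1) (b := 1) (A := m) (B := -n) (by simp) (by simp)
        (by rw [sub_self]; exact zero_mem _)).2 (by ring)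
      simpa using this

end

/-! ### Combinatorics of increasing semimodules -/

section

variable {n m : ℕ} {lam : ℤ → ℕ} {i : ℤ}

theorem mem_truncSemimodule {k : ℕ} :
    k ∈ truncSemimodule n m lam i ↔
      ∃ j : ℤ, -1 ≤ j ∧ j ≤ i ∧ ∃ a b : ℕ, k = lam j + (n * a + m * b) := by
  constructor
  · rintro ⟨j, h1, h2, q, ⟨a, b, rfl⟩, rfl⟩
    exact ⟨j, h1, h2, a, b, rfl⟩
  · rintro ⟨j, h1, h2, a, b, rfl⟩
    exact ⟨j, h1, h2, _, ⟨a, b, rfl⟩, rfl⟩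

theorem truncSemimodule_mono {i' : ℤ} (h : i ≤ i') :
    truncSemimodule n m lam i ⊆ truncSemimodule n m lam i' := by
  rintro k ⟨j, h1, h2, h3⟩
  exact ⟨j, h1, h2.trans h, h3⟩

theorem mem_truncSemimodule_succ {k : ℕ} (hi : -1 ≤ i) :
    k ∈ truncSemimodule n m lam i ↔
      k ∈ truncSemimodule n m lam (i - 1) ∨ ∃ a b : ℕ, k = lam i + (n * a + m * b) := by
  constructor
  · intro h
    rw [mem_truncSemimodule] at h
    obtain ⟨j, h1, h2, a, b, h⟩ := h
    rcases h2.lt_or_eq with h2 | rfl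
    · exact .inl (mem_truncSemimodule.2 ⟨j, h1, by omega, a, b, h⟩)
    · exact .inr ⟨a, b, h⟩
  · rintro (h | ⟨a, b, h⟩)
    · exact truncSemimodule_mono (by omega) h
    · exact mem_truncSemimodule.2 ⟨i, hi, le_rfl, a, b, h⟩

theorem axis_succ (hi : 0 ≤ i) :
    axis n m lam (i + 1) =
      sInf {p | p ∈ truncSemimodule n m lam (i - 1) ∧ ∃ a b : ℕ, p = lam i + (n * a + m * b)} := by
  rw [axis, if_neg (by omega)]
  have e1 : i + 1 - 2 = i - 1 := by ring
  have e2 : i + 1 - 1 = i := by ring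
  rw [e1, e2]
  congr 1
  ext p
  constructor
  · rintro ⟨h1, q, ⟨a, b, rfl⟩, rfl⟩
    exact ⟨h1, a, b, rfl⟩
  · rintro ⟨h1, a, b, rfl⟩
    exact ⟨h1, _, ⟨a, b, rfl⟩, rfl⟩

/-- Beyond the axis `u_i`, the complement of `Λ_{i-1}` is the cone `U - n a - m b`, `a, b ≥ 1`. -/
structure IsConeVertex (n m : ℕ) (lam : ℤ → ℕ) (i : ℤ) (U : ℕ) : Prop where
  le : U ≤ n * m + n
  exists_left : ∃ j h, -1 ≤ j ∧ j < i ∧ U = lam j + n * h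
  exists_right : ∃ j g, -1 ≤ j ∧ j < i ∧ U = lam j + m * g
  exists_eq : ∀ z, axis n m lam i < z → z ∉ truncSemimodule n m lam (i - 1) →
    ∃ a b, 1 ≤ a ∧ 1 ≤ b ∧ z + n * a + m * b = U
  notMem : ∀ z a b, 1 ≤ a → 1 ≤ b → z + n * a + m * b = U →
    z ∉ truncSemimodule n m lam (i - 1)

/-- A positive integer which is not in the semigroup is `n m - n a - m b` with `a, b ≥ 1`. -/
theorem exists_add_eq_of_notMem (hn : 0 < n) (hcop : Nat.Coprime n m) {z : ℕ}
    (hz : ∀ a b, z ≠ n * a + m * b) : ∃ a b, 1 ≤ a ∧ 1 ≤ b ∧ z + n * a + m * b = n * m := by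
  obtain ⟨b, hb, hb'⟩ : ∃ b, b < n ∧ z + m * b ≡ 0 [MOD n] := by
    obtain ⟨y, hy⟩ := Nat.exists_mul_mod_eq_of_coprime (n := m) (n * (z + 1) - z)
      (by simpa [Nat.coprime_comm] using hcop) hn.ne'
    obtain ⟨hy1, hy2⟩ := hy
    refine ⟨y, hy1, ?_⟩
    have hle : z ≤ n * (z + 1) := by nlinarith
    have : z + m * y ≡ z + (n * (z + 1) - z) [MOD n] := Nat.ModEq.add_left _ hy2
    rw [Nat.add_sub_cancel' hle] at this
    exact this.trans (by simp [Nat.ModEq])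
  obtain ⟨q, hq⟩ := (Nat.modEq_zero_iff_dvd).1 hb'
  have hb0 : 1 ≤ b := by
    rcases Nat.eq_zero_or_pos b with rfl | h
    · exact absurd (by simpa using hq) (hz q 0)
    · exact h
  have hqm : q < m := by
    by_contra hqm
    push Not at hqm
    obtain ⟨d, rfl⟩ := Nat.exists_eq_add_of_le hqm
    obtain ⟨b', rfl⟩ := Nat.exists_eq_add_of_le hb.le
    refine hz d b' ?_
    nlinarith
  obtain ⟨d, rfl⟩ := Nat.exists_eq_add_of_lt hqm
  exact ⟨d + 1, b, by omega, hb0, by linarith⟩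

/-- Translate by n the description of the gaps of Γ. A point of the cone in n + Γ would give n m = n
a' + m b' with a', b' ≥ 1, so n would divide b', forcing b' = n and a' = 0. -/
theorem isConeVertex_zero (hn : 0 < n) (hcop : Nat.Coprime n m) (h : lam (-1) = n) :
    IsConeVertex n m lam 0 (n * m + n) where
  le := le_rfl
  exists_left := ⟨-1, m, le_rfl, by omega, by rw [h]; ring⟩
  exists_right := ⟨-1, n, le_rfl, by omega, by rw [h]; ring⟩
  exists_eq := by
    intro z hz hz'
    rw [axis, if_pos rfl, h] at hz
    obtain ⟨y, rfl⟩ := Nat.exists_eq_add_of_le hz.le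
    obtain ⟨a, b, ha, hb, hab⟩ := exists_add_eq_of_notMem hn hcop (z := y) (by
      rintro a b rfl
      exact hz' (mem_truncSemimodule.2 ⟨-1, le_rfl, by omega, a, b, by rw [h]⟩))
    exact ⟨a, b, ha, hb, by omega⟩
  notMem := by
    intro z a b ha hb hz hmem
    obtain ⟨j, h1, h2, c, d, rfl⟩ := mem_truncSemimodule.1 hmem
    obtain rfl : j = -1 := by omega
    rw [h] at hz
    have h3 : n * (a + c) + m * (b + d) = n * m + m * 0 := by linarith
    have hb' : b + d ≤ n := by
      by_contra hlt
      push Not at hlt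
      nlinarith
    have h4 : n ∣ m * (b + d) := by
      have : n ∣ n * (a + c) + m * (b + d) := by rw [h3]; simp
      exact (Nat.dvd_add_right (Dvd.intro _ rfl)).1 this
    have h5 : n ∣ b + d := hcop.dvd_of_dvd_mul_left h4
    have h6 : b + d = n := le_antisymm hb' (Nat.le_of_dvd (by omega) h5)
    rw [h6] at h3
    have : n * (a + c) = 0 := by nlinarith
    have : n * (a + c) ≠ 0 := by positivity
    contradiction

set_option maxHeartbeats 1000000 in
/-- Passing from `Λ_{i-1}` to `Λ_i` in an increasing semimodule. -/
theorem IsConeVertex.succ {U : ℕ} (hU : IsConeVertex n m lam i U) (hn : 0 < n) (hnm : n ≤ m)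
    (hcop : Nat.Coprime n m) (hi : 0 ≤ i) (hlt : ∀ j, -1 ≤ j → j < i → lam j < lam i)
    (hnot : lam i ∉ truncSemimodule n m lam (i - 1)) (haxis : axis n m lam i < lam i) :
    (∃ U', IsConeVertex n m lam (i + 1) U') ∧
    ∃ a₀ b₀, axis n m lam (i + 1) = lam i + (n * a₀ + m * b₀) ∧
      axis n m lam (i + 1) ∈ truncSemimodule n m lam (i - 1) ∧
      ∀ k, k ∉ truncSemimodule n m lam i → ∀ a b,
        lam i + (n * a + m * b) ∈ truncSemimodule n m lam (i - 1) →
        lam i + (n * a + m * b) < k → a₀ ≤ a ∧ b₀ ≤ b := by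
  have hm : 0 < m := hn.trans_le hnm
  -- λ_i is itself a gap beyond u_i, so λ_i = U - n A - m B. The pair (A, B) determines both the
  -- next axis and the next vertex.
  obtain ⟨A, B, hA, hB, hAB⟩ := hU.exists_eq _ haxis hnot
  have hBn : B < n := by
    have := hU.le
    by_contra h
    push Not at h
    nlinarith
  have hAm : A < m := by
    have := hU.le
    by_contra h
    push Not at h
    nlinarith
  -- the two generators of the intersection with `Λ_{i-1}`
  have hmemA : ∃ j g, -1 ≤ j ∧ j < i ∧ lam i + n * A = lam j + m * g := by
    obtain ⟨j, g, h1, h2, h3⟩ := hU.exists_right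
    have hj := hlt j h1 h2
    have : B ≤ g := by
      by_contra h
      push Not at h
      nlinarith
    obtain ⟨d, rfl⟩ := Nat.exists_eq_add_of_le this
    exact ⟨j, d, h1, h2, by linarith⟩
  have hmemB : ∃ j h, -1 ≤ j ∧ j < i ∧ lam i + m * B = lam j + n * h := by
    obtain ⟨j, g, h1, h2, h3⟩ := hU.exists_left
    have hj := hlt j h1 h2
    have : A ≤ g := by
      by_contra h
      push Not at h
      nlinarith
    obtain ⟨d, rfl⟩ := Nat.exists_eq_add_of_le this
    exact ⟨j, d, h1, h2, by linarith⟩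
  have hA' : lam i + n * A ∈ truncSemimodule n m lam (i - 1) := by
    obtain ⟨j, g, h1, h2, h3⟩ := hmemA
    exact mem_truncSemimodule.2 ⟨j, h1, by omega, 0, g, by rw [h3]; ring⟩
  have hB' : lam i + m * B ∈ truncSemimodule n m lam (i - 1) := by
    obtain ⟨j, g, h1, h2, h3⟩ := hmemB
    exact mem_truncSemimodule.2 ⟨j, h1, by omega, g, 0, by rw [h3]; ring⟩
  -- If a < A and b < B, the point is still strictly inside the cone below U, hence a gap of
  -- Λ_{i-1}.
  have hiff : ∀ a b, lam i + (n * a + m * b) ∈ truncSemimodule n m lam (i - 1) →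
      A ≤ a ∨ B ≤ b := by
    intro a b h
    by_contra hcon
    push Not at hcon
    obtain ⟨d, rfl⟩ := Nat.exists_eq_add_of_lt hcon.1
    obtain ⟨f, rfl⟩ := Nat.exists_eq_add_of_lt hcon.2
    exact hU.notMem _ (d + 1) (f + 1) (by omega) (by omega) (by linarith) h
  have hax : axis n m lam (i + 1) = lam i + min (n * A) (m * B) := by
    rw [axis_succ hi]
    refine le_antisymm (Nat.sInf_le ?_) (le_csInf ?_ ?_)
    · rcases le_total (n * A) (m * B) with h | h
      · rw [min_eq_left h]; exact ⟨hA', A, 0, by ring⟩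
      · rw [min_eq_right h]; exact ⟨hB', 0, B, by ring⟩
    · exact ⟨_, hA', A, 0, by ring⟩
    · rintro p ⟨h1, a, b, rfl⟩
      rcases hiff a b h1 with h | h
      · have : n * A ≤ n * a := Nat.mul_le_mul_left _ h
        omega
      · have : m * B ≤ m * b := Nat.mul_le_mul_left _ h
        omega
  -- A point of the old cone outside λ_i + Γ has a > A or b > B. Being beyond u_{i+1} excludes one
  -- alternative, and subtracting A or B from the other coordinate moves the vertex from U to the
  -- larger generator.
  have hcone : ∀ z, axis n m lam (i + 1) < z → z ∉ truncSemimodule n m lam i →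
      ∃ a b, 1 ≤ a ∧ 1 ≤ b ∧ z + n * a + m * b = lam i + max (n * A) (m * B) := by
    intro z hz hz'
    have hz'' : z ∉ truncSemimodule n m lam (i - 1) :=
      fun h => hz' (truncSemimodule_mono (by omega) h)
    obtain ⟨a, b, ha, hb, hab⟩ := hU.exists_eq z (by omega) hz''
    rw [hax] at hz
    have hnot' : ¬ (a ≤ A ∧ b ≤ B) := by
      rintro ⟨h1, h2⟩
      obtain ⟨d, rfl⟩ := Nat.exists_eq_add_of_le h1
      obtain ⟨f, rfl⟩ := Nat.exists_eq_add_of_le h2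
      exact hz' (mem_truncSemimodule.2 ⟨i, by omega, le_rfl, d, f, by linarith⟩)
    rcases le_total (n * A) (m * B) with h | h
    · rw [min_eq_left h] at hz
      rw [max_eq_right h]
      have haA : A < a := by
        by_contra hcon
        push Not at hcon
        have hbB : B < b := by
          by_contra hcon'
          exact hnot' ⟨hcon, by omega⟩
        nlinarith
      obtain ⟨d, rfl⟩ := Nat.exists_eq_add_of_lt haA
      exact ⟨d + 1, b, by omega, hb, by linarith⟩
    · rw [min_eq_right h] at hz
      rw [max_eq_left h]
      have hbB : B < b := by
        by_contra hcon
        push Not at hcon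
        have haA : A < a := by
          by_contra hcon'
          exact hnot' ⟨by omega, hcon⟩
        nlinarith
      obtain ⟨d, rfl⟩ := Nat.exists_eq_add_of_lt hbB
      exact ⟨a, d + 1, ha, by omega, by linarith⟩
  have e1 : i + 1 - 1 = i := by ring
  -- Of the two generators λ_i + n A and λ_i + m B, the smaller is the next axis and the larger the
  -- next vertex.
  refine ⟨⟨lam i + max (n * A) (m * B), ?_, ?_, ?_, ?_, ?_⟩, ?_⟩
  · have h1 := hU.le
    rcases le_total (n * A) (m * B) with h | h
    · rw [max_eq_right h]; omega
    · rw [max_eq_left h]; omega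
  · rcases le_total (n * A) (m * B) with h | h
    · rw [max_eq_right h]
      obtain ⟨j, g, h1, h2, h3⟩ := hmemB
      exact ⟨j, g, h1, by omega, h3⟩
    · rw [max_eq_left h]
      exact ⟨i, A, by omega, by omega, rfl⟩
  · rcases le_total (n * A) (m * B) with h | h
    · rw [max_eq_right h]
      exact ⟨i, B, by omega, by omega, rfl⟩
    · rw [max_eq_left h]
      obtain ⟨j, g, h1, h2, h3⟩ := hmemA
      exact ⟨j, g, h1, by omega, h3⟩
  · rw [e1]; exact hcone
  · rw [e1]
    intro z a b ha hb hz hmem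
    rcases (mem_truncSemimodule_succ (by omega)).1 hmem with hmem | ⟨c, d, rfl⟩
    · rcases le_total (n * A) (m * B) with h | h
      · rw [max_eq_right h] at hz
        exact hU.notMem z (a + A) b (by omega) hb (by linarith) hmem
      · rw [max_eq_left h] at hz
        exact hU.notMem z a (b + B) ha (by omega) (by linarith) hmem
    -- A common point of the new cone and λ_i + Γ would write n A or m B with both coordinates
    -- positive or redistributed; coprimality with A < m and B < n forbids it.
    · rcases le_total (n * A) (m * B) with h | h
      · rw [max_eq_right h] at hz
        have h3 : m * B = n * (a + c) + m * (b + d) := by linarith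
        have h4 : b + d ≤ B := by
          by_contra hcon
          push Not at hcon
          nlinarith
        obtain ⟨f, rfl⟩ := Nat.exists_eq_add_of_le h4
        have h5 : m * f = n * (a + c) := by linarith
        have h6 : n ∣ f := hcop.dvd_of_dvd_mul_left ⟨_, h5⟩
        have h7 : 0 < f := by
          rcases Nat.eq_zero_or_pos f with rfl | h
          · have : 0 < n * (a + c) := by positivity
            omega
          · exact h
        have := Nat.le_of_dvd h7 h6
        omega
      · rw [max_eq_left h] at hz
        have h3 : n * A = n * (a + c) + m * (b + d) := by linarith
        have h4 : a + c ≤ A := by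
          by_contra hcon
          push Not at hcon
          nlinarith
        obtain ⟨f, rfl⟩ := Nat.exists_eq_add_of_le h4
        have h5 : n * f = m * (b + d) := by linarith
        have h6 : m ∣ f := hcop.symm.dvd_of_dvd_mul_left ⟨_, h5⟩
        have h7 : 0 < f := by
          rcases Nat.eq_zero_or_pos f with rfl | h
          · have : 0 < m * (b + d) := by positivity
            omega
          · exact h
        have := Nat.le_of_dvd h7 h6
        omega
  · rcases le_total (n * A) (m * B) with h | h
    · refine ⟨A, 0, by rw [hax, min_eq_left h]; ring, by rw [hax, min_eq_left h]; exact hA', ?_⟩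
      intro k hk a b hab hlt'
      refine ⟨?_, Nat.zero_le _⟩
      -- Otherwise b ≥ B, so λ_i + n a + m b is at least the new vertex, which exceeds every gap k
      -- beyond the axis.
      by_contra hcon
      have hb : m * B ≤ m * b := Nat.mul_le_mul_left _ ((hiff a b hab).resolve_left hcon)
      obtain ⟨a', b', h1, h2, h3⟩ := hcone k (by rw [hax, min_eq_left h]; omega) hk
      rw [max_eq_right h] at h3
      omega
    · refine ⟨0, B, by rw [hax, min_eq_right h]; ring, by rw [hax, min_eq_right h]; exact hB', ?_⟩
      intro k hk a b hab hlt'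
      refine ⟨Nat.zero_le _, ?_⟩
      by_contra hcon
      have ha : n * A ≤ n * a := Nat.mul_le_mul_left _ ((hiff a b hab).resolve_right hcon)
      obtain ⟨a', b', h1, h2, h3⟩ := hcone k (by rw [hax, min_eq_right h]; omega) hk
      rw [max_eq_left h] at h3
      omega

end

/-! ### Critical orders -/

/-- This ends each successive-correction argument: every correction strictly raises a bounded
natural number, so no limit of forms is needed. -/
theorem not_of_forall_exists_lt {V : Type*} {ν : V → ℕ∞} {P : V → Prop} (N : ℕ)
    (hN : ∀ η, P η → ∃ p : ℕ, ν η = p ∧ p ≤ N) (hP : ∀ η, P η → ∃ θ, P θ ∧ ν η < ν θ) (η : V) :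
    ¬ P η := by
  suffices H : ∀ d η, P η → ∀ p : ℕ, ν η = p → N < p + d → False by
    intro h
    obtain ⟨p, hp, -⟩ := hN η h
    exact H (N + 1) η h p hp (by omega)
  intro d
  induction d with
  | zero =>
    intro η h p hp hlt
    obtain ⟨q, hq, hqN⟩ := hN η h
    rw [hp] at hq
    have : p = q := by exact_mod_cast hq
    omega
  | succ d ih =>
    intro η h p hp hlt
    obtain ⟨θ, hθ, hlt'⟩ := hP η h
    obtain ⟨q, hq, -⟩ := hN θ hθ
    rw [hp, hq] at hlt'
    have : p < q := by exact_mod_cast hlt'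
    exact ih θ hθ q hq (by omega)

/-- The basis `lam` of the semimodule of values of `c`. -/
structure IsValueBasis (n m : ℕ) {V : Type*} [AddCommGroup V] [Module ℂ V]
    (mon : ℕ → ℕ → V → V) (c e : V → ℕ∞) (s : ℤ) (lam : ℤ → ℕ) : Prop where
  two_le : 2 ≤ n
  lt : n < m
  coprime : Nat.Coprime n m
  pair : IsOrderPair n m mon c e
  basis : IsSemimoduleBasis n m s lam {k | ∃ η, c η = k}

namespace IsValueBasis

variable {n m : ℕ} {V : Type*} [AddCommGroup V] [Module ℂ V] {mon : ℕ → ℕ → V → V}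
  {c e : V → ℕ∞} {s : ℤ} {lam : ℤ → ℕ}

theorem exists_e_eq (D : IsValueBasis n m mon c e s lam) {η : V} {k : ℕ} (hk : c η = k)
    (hlt : k < n * m) : ∃ p : ℕ, e η = p ∧ p ≤ k := by
  have h1 : e η < ((k + 1 : ℕ) : ℕ∞) := by
    by_contra h
    have h2 := D.pair.le_c η (k + 1) (not_lt.1 h) hlt
    rw [hk] at h2
    have : k + 1 ≤ k := by exact_mod_cast h2
    omega
  obtain ⟨p, hp⟩ := ENat.ne_top_iff_exists.1 h1.ne_top
  refine ⟨p, hp.symm, ?_⟩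
  rw [← hp] at h1
  have : p < k + 1 := by exact_mod_cast h1
  omega

theorem mem_iff (D : IsValueBasis n m mon c e s lam) {k : ℕ} :
    k ∈ truncSemimodule n m lam s ↔ ∃ η, c η = k := by
  rw [← D.basis.eq_trunc]; rfl

theorem lam_lt (D : IsValueBasis n m mon c e s lam) {i j : ℤ} (hj : -1 ≤ j) (hji : j < i)
    (hi : i ≤ s) : lam j < lam i := by
  obtain ⟨d, hd⟩ := Int.exists_add_of_le hji
  have H : ∀ d : ℕ, j + 1 + d ≤ s → lam j < lam (j + 1 + d) := by
    intro d
    induction d with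
    | zero =>
      intro h
      have := D.basis.increasing (j + 1) (by omega) (by simpa using h)
      simpa using this
    | succ d ih =>
      intro h
      have h1 := D.basis.increasing (j + 1 + (d + 1 : ℕ)) (by omega) h
      have e1 : j + 1 + ((d + 1 : ℕ) : ℤ) - 1 = j + 1 + d := by push_cast; ring
      rw [e1] at h1
      exact (ih (by push_cast at h; omega)).trans h1
  rw [hd]
  exact H d (by omega)

theorem exists_c_eq_lam (D : IsValueBasis n m mon c e s lam) {j : ℤ} (hj : -1 ≤ j) (hjs : j ≤ s) :
    ∃ η, c η = lam j :=
  D.mem_iff.1 (mem_truncSemimodule.2 ⟨j, hj, hjs, 0, 0, by simp⟩)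

theorem lam_le (D : IsValueBasis n m mon c e s lam) {i : ℤ} (hi : -1 ≤ i) {k : ℕ} {η : V}
    (hk : c η = k) (hk' : k ∉ truncSemimodule n m lam (i - 1)) : lam i ≤ k := by
  obtain ⟨j, h1, h2, a, b, rfl⟩ := mem_truncSemimodule.1 (D.mem_iff.2 ⟨η, hk⟩)
  have hij : i ≤ j := by
    by_contra h
    exact hk' (mem_truncSemimodule.2 ⟨j, h1, by omega, a, b, rfl⟩)
  rcases hij.lt_or_eq with h | rfl
  · have := D.lam_lt hi h h2
    omega
  · omega

theorem lam_neg_one (D : IsValueBasis n m mon c e s lam) : lam (-1) = n := by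
  have hn := D.two_le
  have hlt := D.lt
  obtain ⟨η, hη⟩ := D.pair.exists_c_eq_left
  obtain ⟨θ, hθ⟩ := D.exists_c_eq_lam le_rfl D.basis.length_ge
  have h1 : lam (-1) ≤ n := D.lam_le le_rfl hη (by
    intro h
    obtain ⟨j, h1, h2, -⟩ := mem_truncSemimodule.1 h
    omega)
  have hnm : n < n * m := by nlinarith
  obtain ⟨p, hp, hp'⟩ := D.exists_e_eq hθ (by omega)
  have := (D.pair.e_mem θ p hp (by omega)).1
  omega

/-- The form dy gives λ_0 ≤ m. Resonance would require order at least n + m, more than the value;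
hence value and order agree and lie in Γ. As n + Γ is excluded, only multiples of m remain. -/
theorem lam_zero (D : IsValueBasis n m mon c e s lam) : 0 ≤ s ∧ lam 0 = m := by
  have hn := D.two_le
  have hlt := D.lt
  have hneg := D.lam_neg_one
  obtain ⟨η, hη⟩ := D.pair.exists_c_eq_right
  have hnot : m ∉ truncSemimodule n m lam (0 - 1) := by
    intro h
    obtain ⟨j, h1, h2, a, b, h3⟩ := mem_truncSemimodule.1 h
    obtain rfl : j = -1 := by omega
    rw [hneg] at h3
    rcases Nat.eq_zero_or_pos b with rfl | hb
    · have h4 : n ∣ m := ⟨1 + a, by rw [h3]; ring⟩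
      have := Nat.Coprime.eq_one_of_dvd D.coprime h4
      omega
    · nlinarith
  have hs : 0 ≤ s := by
    by_contra hs
    have := D.basis.length_ge
    obtain rfl : s = -1 := by omega
    exact hnot (D.mem_iff.2 ⟨η, hη⟩)
  refine ⟨hs, ?_⟩
  have h1 : lam 0 ≤ m := D.lam_le (by omega) hη hnot
  have hnm : m < n * m := by nlinarith
  obtain ⟨θ, hθ⟩ := D.exists_c_eq_lam (j := 0) (by omega) hs
  obtain ⟨p, hp, hp'⟩ := D.exists_e_eq hθ (by omega)
  rcases hp'.lt_or_eq with h | h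
  · obtain ⟨a, b, h2⟩ := D.pair.e_eq_of_lt θ p hp (by omega) (by rw [hθ]; exact_mod_cast h)
    omega
  · obtain ⟨hnp, a, b, hab⟩ := D.pair.e_mem θ p hp (by omega)
    have ha : a = 0 := by
      by_contra ha
      obtain ⟨a, rfl⟩ := Nat.exists_eq_succ_of_ne_zero ha
      refine D.basis.notMem 0 le_rfl hs (mem_truncSemimodule.2 ⟨-1, le_rfl, by omega, a, b, ?_⟩)
      rw [hneg, ← h, hab, Nat.succ_eq_add_one]; ring
    subst ha
    have hb : 1 ≤ b := by
      rcases Nat.eq_zero_or_pos b with rfl | hb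
      · omega
      · exact hb
    nlinarith

theorem mem_of_semigroup (D : IsValueBasis n m mon c e s lam) {i : ℤ} (hi : 0 ≤ i) {k a b : ℕ}
    (hk : k = n * a + m * b) (hk0 : 0 < k) : k ∈ truncSemimodule n m lam i := by
  rcases Nat.eq_zero_or_pos a with rfl | ha
  · rcases Nat.eq_zero_or_pos b with rfl | hb
    · omega
    · obtain ⟨b, rfl⟩ := Nat.exists_eq_succ_of_ne_zero hb.ne'
      refine mem_truncSemimodule.2 ⟨0, by omega, hi, 0, b, ?_⟩
      rw [D.lam_zero.2, hk, Nat.succ_eq_add_one]; ring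
  · obtain ⟨a, rfl⟩ := Nat.exists_eq_succ_of_ne_zero ha.ne'
    refine mem_truncSemimodule.2 ⟨-1, by omega, by omega, a, b, ?_⟩
    rw [D.lam_neg_one, hk, Nat.succ_eq_add_one]; ring

/-- Λ_0 contains every positive element of Γ, and gaps of Γ are below n m. This keeps all relevant
orders in the range where initial parts exist. -/
theorem lt_mul_of_notMem (D : IsValueBasis n m mon c e s lam) {i : ℤ} (hi : 0 ≤ i) {k : ℕ}
    (hk : k ∉ truncSemimodule n m lam i) : k < n * m := by
  have hn := D.two_le
  have hlt := D.lt
  rcases Nat.eq_zero_or_pos k with rfl | hk0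
  · exact Nat.mul_pos (by omega) (by omega)
  · obtain ⟨a, b, ha, hb, hab⟩ := exists_add_eq_of_notMem (by omega) D.coprime (z := k)
      (fun a b h => hk (D.mem_of_semigroup hi h hk0))
    have : 0 < n * a := by positivity
    omega

/-- A form whose value is not in the semigroup is resonant. -/
theorem exists_e_eq_of_notMem (D : IsValueBasis n m mon c e s lam) {i : ℤ} (hi : 0 ≤ i) {η : V}
    {k : ℕ} (hη : c η = k) (hk : k ∉ truncSemimodule n m lam i) :
    ∃ a b, e η = ((n + m + (n * a + m * b) : ℕ) : ℕ∞) ∧ n + m + (n * a + m * b) < k := by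
  have hlt := D.lt_mul_of_notMem hi hk
  obtain ⟨p, hp, hp'⟩ := D.exists_e_eq hη hlt
  rcases hp'.lt_or_eq with h | h
  · obtain ⟨a, b, rfl⟩ := D.pair.e_eq_of_lt η p hp (by omega) (by rw [hη]; exact_mod_cast h)
    exact ⟨a, b, hp, h⟩
  · obtain ⟨hnp, a, b, hab⟩ := D.pair.e_mem η p hp (by omega)
    have := D.two_le
    exact absurd (D.mem_of_semigroup hi (h.symm.trans hab) (by omega)) hk

/-- If the orders of the forms with values outside `Λ_{i-1}` lie in `T + Γ`, a form `θ` of order `T`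
bounds their values. -/
theorem c_add_le (D : IsValueBasis n m mon c e s lam) {i : ℤ} (hi : 1 ≤ i) {T l : ℕ}
    (hT : T < n * m) (hTl : T < l)
    (hQ : ∀ η (k : ℕ), c η = k → k ∉ truncSemimodule n m lam (i - 1) →
      ∃ a b, e η = ((T + (n * a + m * b) : ℕ) : ℕ∞))
    {θ : V} (hθ : e θ = T) (hlθ : (l : ℕ∞) ≤ c θ) {η : V} {k : ℕ} (hη : c η = k)
    (hk : k ∉ truncSemimodule n m lam (i - 1)) {a b : ℕ}
    (hab : e η = ((T + (n * a + m * b) : ℕ) : ℕ∞)) : l + (n * a + m * b) ≤ k := by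
  have hkm := D.lt_mul_of_notMem (by omega) hk
  by_contra hcon
  push Not at hcon
  -- A counterexample can be corrected by x^a y^b θ: its order rises while its value stays k, since
  -- x^a y^b θ has larger value. The order is bounded by k.
  refine not_of_forall_exists_lt (ν := e) (P := fun η => c η = k ∧
    ∃ a b, e η = ((T + (n * a + m * b) : ℕ) : ℕ∞) ∧ k < l + (n * a + m * b)) k
    (fun η h => D.exists_e_eq h.1 hkm) ?_ η ⟨hη, a, b, hab, hcon⟩
  clear hab hcon hη a b η
  rintro η ⟨hη, a, b, hab, hlt⟩
  have hres : T + (n * a + m * b) < k := by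
    obtain ⟨a', b', h1, h2⟩ := D.exists_e_eq_of_notMem (by omega) hη hk
    rw [hab] at h1
    have h1 : T + (n * a + m * b) = n + m + (n * a' + m * b') := by exact_mod_cast h1
    omega
  have h1 : c (mon a b θ) = c θ + ((n * a + m * b : ℕ) : ℕ∞) := D.pair.c_mon a b θ
  have h2 : ((l + (n * a + m * b) : ℕ) : ℕ∞) ≤ c (mon a b θ) := by
    rw [h1]; push_cast; gcongr
  obtain ⟨μ, hμ⟩ := D.pair.resonant η (mon a b θ) _ hab (D.pair.e_mon a b θ T hθ hT) (by omega)
    (by rw [hη]; exact_mod_cast hres)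
    (lt_of_lt_of_le (by exact_mod_cast (by omega)) h2)
  have h3 : c (η - μ • mon a b θ) = k := by
    rw [D.pair.isOrder_c.sub_smul_of_lt _ μ, hη]
    rw [hη]
    exact lt_of_lt_of_le (by exact_mod_cast hlt) h2
  obtain ⟨a', b', h4⟩ := hQ _ k h3 hk
  rw [← hab] at hμ
  refine ⟨η - μ • mon a b θ, ⟨h3, a', b', h4, ?_⟩, hμ⟩
  rw [hab, h4] at hμ
  have : T + (n * a + m * b) < T + (n * a' + m * b') := by exact_mod_cast hμ
  omega

/-- A form of order `T` may be modified into one with value at least `λ_i`. -/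
theorem exists_lam_le_c (D : IsValueBasis n m mon c e s lam) {i : ℤ} (hi : 0 ≤ i)
    {T u : ℕ} (hu : ∀ k, u < k → k ∈ truncSemimodule n m lam (i - 1) →
      ∃ η, c η = k ∧ (T : ℕ∞) < e η)
    {θ : V} (hθ : e θ = T) (huθ : (u : ℕ∞) < c θ) : ∃ θ, e θ = T ∧ (lam i : ℕ∞) ≤ c θ := by
  by_contra hcon
  push Not at hcon
  -- A value below λ_i lies in Λ_{i-1}, so it can be cancelled by a form of order greater than T.
  -- This raises the value and preserves the order.
  refine not_of_forall_exists_lt (ν := c) (P := fun θ => e θ = T ∧ (u : ℕ∞) < c θ) (lam i)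
    ?_ ?_ θ ⟨hθ, huθ⟩
  · rintro η ⟨h1, -⟩
    have h2 := hcon η h1
    obtain ⟨k, hk⟩ := ENat.ne_top_iff_exists.1 h2.ne_top
    refine ⟨k, hk.symm, ?_⟩
    rw [← hk] at h2
    exact_mod_cast h2.le
  · rintro η ⟨h1, h3⟩
    have h2 := hcon η h1
    obtain ⟨k, hk⟩ := ENat.ne_top_iff_exists.1 h2.ne_top
    rw [← hk] at h2 h3
    have hk' : k ∈ truncSemimodule n m lam (i - 1) := by
      by_contra h
      have := D.lam_le (by omega) hk.symm h
      have : k < lam i := by exact_mod_cast h2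
      omega
    obtain ⟨ρ, hρ, hρ'⟩ := hu k (by exact_mod_cast h3) hk'
    obtain ⟨μ, hμ⟩ := D.pair.cancel η ρ k hk.symm hρ
    refine ⟨η - μ • ρ, ⟨?_, h3.trans hμ⟩, by rwa [← hk]⟩
    rw [D.pair.isOrder_e.sub_smul_of_lt (by rwa [h1]) μ, h1]

end IsValueBasis

/-- The properties of the forms with value `λ_i` and of the critical order `t_i`. -/
structure IsCritical (n m : ℕ) {V : Type*} (c e : V → ℕ∞) (lam : ℤ → ℕ) (i : ℕ) : Prop where
  axis_lt : axis n m lam i < lam i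
  order_lt : critOrder n m lam i < lam i
  e_eq : ∀ η, c η = lam i → e η = critOrder n m lam i
  exists_e_eq : ∀ η (k : ℕ), c η = k → k ∉ truncSemimodule n m lam (i - 1) →
    ∃ a b, e η = ((critOrder n m lam i + (n * a + m * b) : ℕ) : ℕ∞) ∧
      lam i + (n * a + m * b) ≤ k
  gap_lt : ∀ j : ℤ, -1 ≤ j → j < i → ∃ p : ℕ, (∀ η, c η = lam j → e η = p) ∧ p < n * m ∧
    critOrder n m lam i + lam j < p + lam i
  cone : ∃ U, IsConeVertex n m lam i U

/-! ### Induction on the critical orders -/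

namespace IsValueBasis

variable {n m : ℕ} {V : Type*} [AddCommGroup V] [Module ℂ V] {mon : ℕ → ℕ → V → V}
  {c e : V → ℕ∞} {s : ℤ} {lam : ℤ → ℕ}

/-- The inductive step, once a form of order `t_i` and large value is known. -/
theorem isCritical_of_exists (D : IsValueBasis n m mon c e s lam) {i : ℕ} (hi : 1 ≤ i)
    (his : (i : ℤ) ≤ s) {θ : V} (hθ : e θ = critOrder n m lam i) (hθ' : (lam i : ℕ∞) ≤ c θ)
    (hQ : ∀ η (k : ℕ), c η = k → k ∉ truncSemimodule n m lam (i - 1) →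
      ∃ a b, e η = ((critOrder n m lam i + (n * a + m * b) : ℕ) : ℕ∞))
    (haxis : axis n m lam i < lam i)
    (hgap : ∀ j : ℤ, -1 ≤ j → j < i → ∃ p : ℕ, (∀ η, c η = lam j → e η = p) ∧ p < n * m ∧
      critOrder n m lam i + lam j < p + lam i)
    (hcone : ∃ U, IsConeVertex n m lam i U) : IsCritical n m c e lam i := by
  have hnot := D.basis.notMem i (by omega) his
  have hlm := D.lt_mul_of_notMem (by omega) hnot
  obtain ⟨ρ, hρ⟩ := D.exists_c_eq_lam (j := i) (by omega) his
  have hTl : critOrder n m lam i < lam i := by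
    obtain ⟨a, b, h1⟩ := hQ ρ _ hρ hnot
    obtain ⟨a', b', h2, h3⟩ := D.exists_e_eq_of_notMem (by omega) hρ hnot
    rw [h1] at h2
    have h2 : critOrder n m lam i + (n * a + m * b) = n + m + (n * a' + m * b') := by
      exact_mod_cast h2
    omega
  have he : ∀ η, c η = lam i → e η = critOrder n m lam i := by
    intro η hη
    obtain ⟨a, b, h1⟩ := hQ η _ hη hnot
    -- The bound λ_i + n a + m b ≤ λ_i leaves no room for a nontrivial monomial.
    have h2 := D.c_add_le (by omega) (hTl.trans hlm) hTl hQ hθ hθ' hη hnot h1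
    have h3 : n * a + m * b = 0 := by omega
    rw [h1, h3, add_zero]
  refine ⟨haxis, hTl, he, fun η k hη hk => ?_, hgap, hcone⟩
  obtain ⟨a, b, h1⟩ := hQ η k hη hk
  exact ⟨a, b, h1, D.c_add_le (by omega) (hTl.trans hlm) hTl hQ (he ρ hρ) hρ.ge hη hk h1⟩

theorem axis_one (D : IsValueBasis n m mon c e s lam) : axis n m lam 1 = n + m := by
  have hn := D.two_le
  have hlt := D.lt
  have h0 := D.lam_zero.2
  have hneg := D.lam_neg_one
  have h : axis n m lam 1 = axis n m lam (0 + 1) := by norm_num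
  rw [h, axis_succ le_rfl]
  have hmem : n + m ∈ {p | p ∈ truncSemimodule n m lam (0 - 1) ∧
      ∃ a b : ℕ, p = lam 0 + (n * a + m * b)} :=
    ⟨mem_truncSemimodule.2 ⟨-1, le_rfl, by omega, 0, 1, by rw [hneg]; ring⟩, 1, 0,
      by rw [h0]; ring⟩
  refine le_antisymm (Nat.sInf_le hmem) (le_csInf ⟨_, hmem⟩ ?_)
  rintro p ⟨h1, a, b, rfl⟩
  rw [h0]
  rcases Nat.eq_zero_or_pos a with rfl | ha
  · rcases Nat.eq_zero_or_pos b with rfl | hb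
    · exact absurd (by simpa using h1) (D.basis.notMem 0 le_rfl D.lam_zero.1)
    · nlinarith
  · nlinarith

theorem critOrder_one (D : IsValueBasis n m mon c e s lam) : critOrder n m lam 1 = n + m := by
  have h := D.axis_one
  have h0 := D.lam_zero.2
  simp only [critOrder]
  norm_num
  rw [h, h0]
  omega

/-- Here t_1 = u_1 = n + m. Values outside Λ_0 come from resonant forms, so their orders lie in n +
m + Γ; forms of value n or m have order equal to their value. The starting form is the resonant one
of order n + m. -/
theorem isCritical_one (D : IsValueBasis n m mon c e s lam) (hs : 1 ≤ s) :
    IsCritical n m c e lam 1 := by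
  have hn := D.two_le
  have hlt := D.lt
  have h0 := D.lam_zero.2
  have hneg := D.lam_neg_one
  have haxis := D.axis_one
  have hT := D.critOrder_one
  have hmm : m < n * m := by nlinarith
  have hcm : ∀ k, k < n * m → k ≤ m → ∀ η, c η = k → e η = k := by
    intro k hk hkm η hη
    obtain ⟨p, hp, hp'⟩ := D.exists_e_eq hη hk
    rcases hp'.lt_or_eq with h | h
    · obtain ⟨a, b, h2⟩ := D.pair.e_eq_of_lt η p hp (by omega) (by rw [hη]; exact_mod_cast h)
      omega
    · rw [hp, h]
  have hlam1 : n + m < lam 1 := by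
    obtain ⟨ρ, hρ⟩ := D.exists_c_eq_lam (j := 1) (by omega) hs
    obtain ⟨a, b, -, h⟩ := D.exists_e_eq_of_notMem (i := 0) le_rfl hρ
      (by simpa using D.basis.notMem 1 (by omega) hs)
    omega
  obtain ⟨θ, hθ, hθ'⟩ := D.pair.exists_resonant
  have hgen : ∀ k, n + m < k → k ∈ truncSemimodule n m lam (1 - 1) →
      ∃ η, c η = k ∧ ((n + m : ℕ) : ℕ∞) < e η := by
    intro k hk hmem
    obtain ⟨j, h1, h2, a, b, rfl⟩ := mem_truncSemimodule.1 hmem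
    have hj : lam j ≤ m ∧ j ≤ s := by
      obtain rfl | rfl : j = -1 ∨ j = 0 := by omega
      · exact ⟨by omega, by omega⟩
      · exact ⟨by omega, by omega⟩
    obtain ⟨η, hη⟩ := D.exists_c_eq_lam h1 hj.2
    refine ⟨mon a b η, ?_, ?_⟩
    · rw [D.pair.c_mon, hη]; push_cast; rfl
    · rw [D.pair.e_mon a b η (lam j) (hcm _ (by omega) hj.1 η hη) (by omega)]
      exact_mod_cast hk
  obtain ⟨θ₁, hθ₁, hθ₁'⟩ := D.exists_lam_le_c (i := 1) (by omega) hgen hθ hθ'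
  refine D.isCritical_of_exists le_rfl (by simpa using hs) (θ := θ₁) (by rw [hT, hθ₁])
    (by simpa using hθ₁') ?_ ?_ ?_ ?_
  · intro η k hη hk
    rw [hT]
    obtain ⟨a, b, h, -⟩ := D.exists_e_eq_of_notMem (by norm_num) hη hk
    exact ⟨a, b, h⟩
  · simpa [haxis] using hlam1
  · intro j h1 h2
    rw [hT]
    have hj : lam j ≤ m := by
      push_cast at h2
      obtain rfl | rfl : j = -1 ∨ j = 0 := by omega
      · omega
      · omega
    refine ⟨lam j, hcm _ (by omega) hj, by omega, ?_⟩
    push_cast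
    omega
  · have h1 := (isConeVertex_zero (by omega) D.coprime hneg).succ (by omega) hlt.le D.coprime le_rfl
      (fun j hj hj' => D.lam_lt hj hj' D.lam_zero.1) (D.basis.notMem 0 le_rfl D.lam_zero.1)
      (by rw [axis, if_pos rfl, h0, hneg]; exact hlt)
    simpa using h1.1

theorem isCritical_succ (D : IsValueBasis n m mon c e s lam) {i : ℕ} (hi : 1 ≤ i)
    (his : ((i + 1 : ℕ) : ℤ) ≤ s) (C : IsCritical n m c e lam i) :
    IsCritical n m c e lam (i + 1) := by
  have hn := D.two_le
  have hlt := D.lt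
  have his' : ((i : ℕ) : ℤ) ≤ s := by push_cast at his; omega
  have hnot := D.basis.notMem i (by omega) his'
  have hlm := D.lt_mul_of_notMem (by omega) hnot
  have hlT := C.order_lt
  obtain ⟨U, hU⟩ := C.cone
  obtain ⟨hcone, a₀, b₀, hax, haxmem, hmin⟩ := hU.succ (by omega) hlt.le D.coprime (by omega)
    (fun j hj hj' => D.lam_lt hj hj' his') hnot C.axis_lt
  obtain ⟨ρ, hρ⟩ := D.exists_c_eq_lam (j := i) (by omega) his'
  have hρe := C.e_eq ρ hρ
  have hT : critOrder n m lam (i + 1) = critOrder n m lam i + (n * a₀ + m * b₀) := by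
    simp only [critOrder]; omega
  have hsub : (((i + 1 : ℕ) : ℤ) - 1) = i := by push_cast; ring
  have key : ∀ η (k : ℕ), c η = k → k ∉ truncSemimodule n m lam i →
      axis n m lam (i + 1) < k ∧
        ∃ a b, e η = ((critOrder n m lam (i + 1) + (n * a + m * b) : ℕ) : ℕ∞) := by
    intro η k hη hk
    have hk' : k ∉ truncSemimodule n m lam (i - 1) :=
      fun h => hk (truncSemimodule_mono (by omega) h)
    obtain ⟨a, b, he, hle⟩ := C.exists_e_eq η k hη hk'
    have hlt' : lam i + (n * a + m * b) < k := by
      refine lt_of_le_of_ne hle fun h => hk ?_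
      exact mem_truncSemimodule.2 ⟨i, by omega, le_rfl, a, b, h.symm⟩
    have hkm := D.lt_mul_of_notMem (by omega) hk
    have hc := D.pair.c_mon a b ρ
    rw [hρ] at hc
    -- Both forms are resonant of the same order. Their combination keeps the smaller value λ_i + n
    -- a + m b but has strictly larger order.
    obtain ⟨μ, hμ⟩ := D.pair.resonant η (mon a b ρ) _ he
      (D.pair.e_mon a b ρ _ hρe (hlT.trans hlm)) (by omega)
      (by rw [hη]; exact_mod_cast (by omega)) (by rw [hc]; exact_mod_cast (by omega))
    have hμ0 : μ ≠ 0 := by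
      rintro rfl
      rw [zero_smul, sub_zero, he] at hμ
      exact lt_irrefl _ hμ
    have hc' : c (η - μ • mon a b ρ) = ((lam i + (n * a + m * b) : ℕ) : ℕ∞) := by
      rw [D.pair.isOrder_c.sub_smul_of_gt _ hμ0, hc]
      · push_cast; rfl
      · rw [hc, hη]; exact_mod_cast hlt'
    -- Were this value outside Λ_{i-1}, the induction hypothesis would bound the order by t_i + n a
    -- + m b, which has just been exceeded.
    have hmem : lam i + (n * a + m * b) ∈ truncSemimodule n m lam (i - 1) := by
      by_contra hcon
      obtain ⟨a', b', h1, h2⟩ := C.exists_e_eq _ _ hc' hcon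
      rw [h1] at hμ
      have : critOrder n m lam i + (n * a + m * b) < critOrder n m lam i + (n * a' + m * b') := by
        exact_mod_cast hμ
      omega
    obtain ⟨ha, hb⟩ := hmin k hk a b hmem hlt'
    obtain ⟨a, rfl⟩ := Nat.exists_eq_add_of_le ha
    obtain ⟨b, rfl⟩ := Nat.exists_eq_add_of_le hb
    refine ⟨?_, a, b, ?_⟩
    · rw [hax]; rw [mul_add, mul_add] at hlt'; omega
    · rw [he, hT]; congr 1; ring
  have hnot' := D.basis.notMem (i + 1 : ℕ) (by omega) his
  rw [hsub] at hnot'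
  have hlm' := D.lt_mul_of_notMem (by omega) hnot'
  obtain ⟨σ, hσ⟩ := D.exists_c_eq_lam (j := (i + 1 : ℕ)) (by omega) his
  have haxis : axis n m lam (i + 1) < lam (i + 1 : ℕ) := (key σ _ hσ hnot').1
  -- The gap inequality says that, for j < i, order minus value is larger for ω_j than for ω_i.
  -- Since u_{i+1} - λ_i = t_{i+1} - t_i, multiples of ω_j with value at least u_{i+1} have order
  -- greater than t_{i+1}.
  have hgen : ∀ k, axis n m lam (i + 1) ≤ k → k ∈ truncSemimodule n m lam (i - 1) →
      ∃ η, c η = k ∧ (critOrder n m lam (i + 1) : ℕ∞) < e η := by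
    intro k hk hmem
    obtain ⟨j, h1, h2, a, b, rfl⟩ := mem_truncSemimodule.1 hmem
    obtain ⟨p, hp, hpm, hp'⟩ := C.gap_lt j h1 (by omega)
    obtain ⟨η, hη⟩ := D.exists_c_eq_lam h1 (by omega)
    refine ⟨mon a b η, ?_, ?_⟩
    · rw [D.pair.c_mon, hη]; push_cast; rfl
    · rw [D.pair.e_mon a b η p (hp η hη) hpm]
      exact_mod_cast (by omega)
  have hgen' : ∀ k, axis n m lam (i + 1) < k →
      k ∈ truncSemimodule n m lam (((i + 1 : ℕ) : ℤ) - 1) →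
      ∃ η, c η = k ∧ (critOrder n m lam (i + 1) : ℕ∞) < e η := by
    intro k hk hmem
    rw [hsub] at hmem
    rcases (mem_truncSemimodule_succ (by omega)).1 hmem with hmem | ⟨a, b, rfl⟩
    · exact hgen k hk.le hmem
    · refine ⟨mon a b ρ, ?_, ?_⟩
      · rw [D.pair.c_mon, hρ]; push_cast; rfl
      · rw [D.pair.e_mon a b ρ _ hρe (hlT.trans hlm)]
        exact_mod_cast (by omega)
  -- The value u_{i+1} is attained both by x^a₀ y^b₀ ω_i, of order t_{i+1}, and by a multiple of an
  -- earlier form, of larger order. Cancelling the values keeps the order t_{i+1}.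
  obtain ⟨θ₀, hθ₀, hθ₀'⟩ : ∃ θ, e θ = critOrder n m lam (i + 1) ∧
      (axis n m lam (i + 1) : ℕ∞) < c θ := by
    obtain ⟨η, hη, hη'⟩ := hgen _ le_rfl haxmem
    have h1 : c (mon a₀ b₀ ρ) = axis n m lam (i + 1) := by
      rw [D.pair.c_mon, hρ, hax]; push_cast; rfl
    have h2 : e (mon a₀ b₀ ρ) = critOrder n m lam (i + 1) := by
      rw [D.pair.e_mon a₀ b₀ ρ _ hρe (hlT.trans hlm), hT]
    obtain ⟨μ, hμ⟩ := D.pair.cancel _ _ _ h1 hη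
    exact ⟨_, by rw [D.pair.isOrder_e.sub_smul_of_lt (by rwa [h2]) μ, h2], hμ⟩
  obtain ⟨θ, hθ, hθ'⟩ := D.exists_lam_le_c (i := (i + 1 : ℕ)) (by omega) hgen' hθ₀ hθ₀'
  have hcast : ((i + 1 : ℕ) : ℤ) = i + 1 := by push_cast; rfl
  refine D.isCritical_of_exists (by omega) his hθ hθ' ?_ (by rwa [hcast] at haxis ⊢) ?_
    (by rwa [hcast])
  · intro η k hη hk
    rw [hsub] at hk
    exact (key η k hη hk).2
  · intro j h1 h2
    rcases (show j ≤ i by omega).lt_or_eq with h | rfl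
    · obtain ⟨p, hp, hpm, hp'⟩ := C.gap_lt j h1 h
      exact ⟨p, hp, hpm, by omega⟩
    -- For j = i the gap inequality amounts to u_{i+1} < λ_{i+1}.
    · exact ⟨critOrder n m lam i, C.e_eq, hlT.trans hlm, by omega⟩

theorem isCritical (D : IsValueBasis n m mon c e s lam) {i : ℕ} (hi : 1 ≤ i) (his : (i : ℤ) ≤ s) :
    IsCritical n m c e lam i := by
  induction i, hi using Nat.le_induction with
  | base => exact D.isCritical_one (by simpa using his)
  | succ i hi ih => exact D.isCritical_succ hi his (ih (by push_cast at his; omega))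

end IsValueBasis

/-! ### Application to cusps and the main theorem -/

theorem IsCusp.isValueBasis {n m : ℕ} (hn : 2 ≤ n) (hnm : n ≤ m) (hcop : Nat.Coprime n m)
    {φ : ℂ → ℂ × ℂ} (hφ : IsCusp n m φ) {s : ℤ} {lam : ℤ → ℕ}
    (hlam : IsSemimoduleBasis n m s lam (diffSemimodule φ)) :
    IsValueBasis n m monomialMulHol (fun η : holomorphicForms => diffValue φ η.1)
      (fun η : holomorphicForms => divisorialOrder n m η.1) s lam where
  two_le := hn
  lt := by
    refine lt_of_le_of_ne hnm ?_
    rintro rfl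
    have : n = 1 := by simpa using hcop
    omega
  coprime := hcop
  pair := by
    obtain ⟨X, Y, ξ, ζ, h⟩ := hφ.exists_isWeightedParam hn hnm hcop
    exact h.isOrderPair (by omega) hnm hcop
  basis := by
    convert hlam using 1
    ext k
    constructor
    · rintro ⟨η, h⟩
      exact ⟨η.1, η.2, h⟩
    · rintro ⟨η, h, h'⟩
      exact ⟨⟨η, h⟩, h'⟩

end CuspSemimodule

end

theorem mainTheorem3 (n m : ℕ) (hn : 2 ≤ n) (hnm : n ≤ m) (hcop : Nat.Coprime n m)
    (φ : ℂ → ℂ × ℂ) (hφ : IsCusp n m φ)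
    (s : ℤ) (lam : ℤ → ℕ) (hlam : IsSemimoduleBasis n m s lam (diffSemimodule φ))
    (ω : ℤ → Form) (hω : IsStandardBasis φ s lam ω)
    (i : ℕ) (hi : 1 ≤ i) (his : (i : ℤ) ≤ s) :
    -- (1)
    IsLUB {v : ℕ∞ | ∃ η : Form, IsHolomorphicForm η ∧
        divisorialOrder n m η = (critOrder n m lam i : ℕ∞) ∧ diffValue φ η = v}
      ((lam i : ℕ) : ℕ∞) ∧
    -- (2)
    (∀ η : Form, IsHolomorphicForm η → diffValue φ η = ((lam i : ℕ) : ℕ∞) →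
      divisorialOrder n m η = (critOrder n m lam i : ℕ∞)) ∧
    -- (3)
    (∀ η : Form, IsHolomorphicForm η → ∀ k : ℕ, diffValue φ η = (k : ℕ∞) →
      k ∉ truncSemimodule n m lam ((i : ℤ) - 1) →
      Reachable n m η (ω i) ∧
      (∃! ab : ℕ × ℕ,
        divisorialOrder n m η = divisorialOrder n m (monomialMul ab.1 ab.2 (ω i))) ∧
      ∀ a b : ℕ, divisorialOrder n m η = divisorialOrder n m (monomialMul a b (ω i)) →
        lam i + n * a + m * b ≤ k) ∧
    -- (4)
    axis n m lam i < lam i ∧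
    -- (5)
    (∀ a b : ℕ, lam i + n * a + m * b ∉ truncSemimodule n m lam ((i : ℤ) - 1) ↔
      ∀ η : Form, IsHolomorphicForm η →
        diffValue φ η = ((lam i + n * a + m * b : ℕ) : ℕ∞) →
        divisorialOrder n m η ≤ divisorialOrder n m (monomialMul a b (ω i))) ∧
    -- consequence
    IsIncreasing n m (truncSemimodule n m lam i) := by
  have D := hφ.isValueBasis hn hnm hcop hlam
  have P := D.pair
  have C := D.isCritical hi his
  have hnot := hlam.notMem i (by omega) his
  have hlm := D.lt_mul_of_notMem (by omega) hnot
  have hTl := C.order_lt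
  have hTm := hTl.trans hlm
  obtain ⟨hωi, hωc⟩ := hω i (by omega) his
  have hωe : divisorialOrder n m (ω i) = critOrder n m lam i := C.e_eq ⟨ω i, hωi⟩ hωc
  have hmonc : ∀ a b, diffValue φ (monomialMul a b (ω i)) =
      ((lam i + (n * a + m * b) : ℕ) : ℕ∞) := by
    intro a b
    have h := P.c_mon a b ⟨ω i, hωi⟩
    simp only [hωc] at h
    exact h.trans (by push_cast; rfl)
  have hmone : ∀ a b, divisorialOrder n m (monomialMul a b (ω i)) =
      ((critOrder n m lam i + (n * a + m * b) : ℕ) : ℕ∞) :=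
    fun a b => P.e_mon a b ⟨ω i, hωi⟩ _ hωe hTm
  refine ⟨⟨?_, ?_⟩, fun η h h' => C.e_eq ⟨η, h⟩ h', ?_, C.axis_lt, fun a b => ⟨?_, ?_⟩, i, lam,
    ⟨by omega, fun j h1 h2 => hlam.increasing j h1 (h2.trans his),
      fun j h1 h2 => hlam.notMem j h1 (h2.trans his), rfl⟩, ?_⟩
  · rintro v ⟨η, hη, he, rfl⟩
    by_contra hcon
    have hcon : ((lam i : ℕ) : ℕ∞) < diffValue φ η := not_le.1 hcon
    have hTl' : (critOrder n m lam i : ℕ∞) < ((lam i : ℕ) : ℕ∞) := by exact_mod_cast hTl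
    -- A form of order t_i and larger value could be used to raise the order of ω_i while keeping
    -- its value λ_i, contradicting (2).
    obtain ⟨μ, hμ⟩ := P.resonant ⟨ω i, hωi⟩ ⟨η, hη⟩ _ hωe he hTm (hTl'.trans_eq hωc.symm)
      (hTl'.trans hcon)
    have h1 := P.isOrder_c.sub_smul_of_lt (η := ⟨ω i, hωi⟩) (θ := ⟨η, hη⟩) (hωc.trans_lt hcon) μ
    exact absurd (C.e_eq _ (h1.trans hωc)) hμ.ne'
  · exact fun v hv => hv ⟨ω i, hωi, hωe, hωc⟩
  · intro η hη k hk hkn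
    have hkm := D.lt_mul_of_notMem (by omega) hkn
    obtain ⟨a, b, he, hle⟩ := C.exists_e_eq ⟨η, hη⟩ k hk hkn
    have he : divisorialOrder n m η = ((critOrder n m lam i + (n * a + m * b) : ℕ) : ℕ∞) := he
    have huniq : ∀ a' b', divisorialOrder n m η = divisorialOrder n m (monomialMul a' b' (ω i)) →
        a' = a ∧ b' = b := by
      intro a' b' h
      rw [he, hmone] at h
      have h : critOrder n m lam i + (n * a + m * b) =
        critOrder n m lam i + (n * a' + m * b') := by exact_mod_cast h
      obtain ⟨rfl, rfl⟩ := weight_injective hcop (a := a) (b := b) (a' := a') (b' := b')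
        (by omega) (by omega)
      exact ⟨rfl, rfl⟩
    refine ⟨?_, ⟨(a, b), by simp only; rw [he, hmone], fun ab h => ?_⟩, fun a' b' h => ?_⟩
    · obtain ⟨μ, hμ⟩ := P.resonant ⟨η, hη⟩ (monomialMulHol a b ⟨ω i, hωi⟩) _ he (hmone a b)
        (by omega) (lt_of_lt_of_eq (by exact_mod_cast (by omega)) hk.symm)
        (lt_of_lt_of_eq (by exact_mod_cast (by omega)) (hmonc a b).symm)
      exact ⟨a, b, μ, he.trans_lt hμ⟩
    · obtain ⟨h1, h2⟩ := huniq _ _ h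
      exact Prod.ext h1 h2
    · obtain ⟨rfl, rfl⟩ := huniq _ _ h
      rwa [add_assoc]
  · intro hkn η hη hk
    obtain ⟨a', b', he, hle⟩ := C.exists_e_eq ⟨η, hη⟩ _ hk hkn
    refine he.trans_le ?_
    rw [hmone]
    exact_mod_cast (by omega)
  · intro h hmem
    obtain ⟨j, h1, h2, a', b', hj⟩ := mem_truncSemimodule.1 hmem
    -- If the value lies in Λ_{i-1}, a multiple of an earlier basis form attains it, and the gap
    -- inequality makes its order exceed that of x^a y^b ω_i.
    obtain ⟨p, hp, hpm, hp'⟩ := C.gap_lt j h1 (by omega)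
    obtain ⟨η, hη⟩ := D.exists_c_eq_lam h1 (by omega)
    have h3 := h (monomialMul a' b' η.1) (IsHolomorphicForm.monomialMul η.2 a' b')
      ((P.c_mon a' b' η).trans (by rw [hη, hj]; push_cast; rfl))
    rw [hmone] at h3
    have h4 := (P.e_mon a' b' η p (hp η hη) hpm).symm.le.trans h3
    have h5 : p + (n * a' + m * b') ≤ critOrder n m lam i + (n * a + m * b) := by
      exact_mod_cast h4
    omega
  · intro j h1 h2
    rcases h1.lt_or_eq with h | rfl
    · obtain ⟨j, rfl⟩ := Int.eq_ofNat_of_zero_le h1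
      exact (D.isCritical (by omega) (h2.trans his)).axis_lt
    · rw [axis, if_pos rfl]
      exact D.lam_lt le_rfl (by omega) D.lam_zero.1
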